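/- **Notation.** For $F\in C^2(\mathbb R)$ (derivatives up to order $2$ continuous and bounded) put $\|F\|_{C^2(\mathbb R)}=\sup_{t}\max_{m\le 2}|F^{(m)}(t)|$; $C^2_+(\mathbb R)$ is the set of $F\in C^2(\mathbb R)$ with $F\ge 0$. For a finite set $E\subset\mathbb R$ with $\#E=N$, $C^2_+(E)$ is the set of all $f:E\to[0,\infty)$, identified with $[0,\infty)^N$, and $\|f\|_{C^2_+(E)}=\inf\{\|F\|_{C^2(\mathbb R)}: F\in C^2_+(\mathbb R),\ F|_E=f\}$. $\overline{\mathcal P}^+$ is the space of real polynomials of degree at most $2$, and $\overline{\mathscr J}{}^+_tF\in\overline{\mathcal P}^+$ is the second-order Taylor polynomial of $F$ at $t$. A map $\Xi$ on $C^2_+(E)$ has depth $D$ if there is $S\subset E$ with $\#S\le D$ such that $\Xi(f)=\Xi(g)$ whenever $f|_S=g|_S$. An efficient representation of such a $\Xi$ (with values in $\overline{\mathcal P}^+$) is a specification of the indices of the points of such a set $S$ together with an algorithm (a fixed program supplied with a bounded number of real constants) which from the values of $f$ on $S$, for $f\in C^2_+(E)$ vanishing off $S$, computes $\Xi(f)$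 in a number of operations bounded by a universal constant. Algorithms are programs for a random access machine with exact real numbers: unit cost for the four field operations on and comparison of reals, for addition, subtraction, halving and comparison of integers, and for access to memory at a computed integer address; storage is the number of memory cells used, and the integers stored are bounded by the storage bound. **Theorem.** There are universal constants $C$, $D_0$ and one algorithm such that for every finite set $E\subset\mathbb R$, $N=\#E$, there is a family of maps $\Xi^t:C^2_+(E)\to\overline{\mathcal P}^+$ $(t\in\mathbb R)$ with the following properties. (A) For each $t\in\mathbb R$ the map $\Xi^t$ has depth $D_0$. (B) For each $f\in C^2_+(E)$ there is $F\in C^2_+(\mathbb R)$ with $\overline{\mathscr J}{}^+_tF=\Xi^t(f)$ for all $t\in\mathbb R$, $\|F\|_{C^2(\mathbb R)}\le C\|f\|_{C^2_+(E)}$, and $F=f$ on $E$. (C) The algorithm takes the points of $E$, listed in any order, performs one-time work, and then responds to queries. A query is a point $t\in\mathbb R$; the response is the map $\Xi^t$, given in an efficient representation with at most $D_0$ indices. The one-time work takes at most $C(1+N\log N)$ operations and $C(1+N)$ storage; a query is answered in at most $C(1+\log N)$ operations (where $N\log N$ and $\log N$ are read as $0$ for $N=0$). -/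

import Mathlib

open scoped NNReal ENNReal Polynomial

/-! ### Two-jets, the space of nonnegative `C²` functions, trace norms, depth -/

noncomputable section

/-- The norm `sup_t max_{m ≤ 2} |F^{(m)}(t)|` of `C²(ℝ)`, with values in `[0, ∞]`. -/
def c2Norm (F : ℝ → ℝ) : ℝ≥0∞ :=
  ⨆ (t : ℝ) (m : Fin 3), ‖iteratedDeriv m F t‖ₑ

/-- `F ∈ C²₊(ℝ)`: `F` is twice continuously differentiable, its derivatives up to order two are
bounded, and `F ≥ 0`. -/
def IsC2Plus (F : ℝ → ℝ) : Prop :=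
  ContDiff ℝ 2 F ∧ c2Norm F < ∞ ∧ ∀ t, 0 ≤ F t

/-- The trace norm of `f : E → [0, ∞)`: the infimum of `‖G‖_{C²(ℝ)}` over all `G ∈ C²₊(ℝ)` with
`G = f` on `E`. -/
def traceNorm {E : Finset ℝ} (f : E → ℝ≥0) : ℝ≥0∞ :=
  ⨅ (G : ℝ → ℝ) (_ : IsC2Plus G ∧ ∀ a : E, G a = f a), c2Norm G

/-- The two-jet of `F` at `t`, identified with the Taylor polynomial of degree two. -/
def jet2 (F : ℝ → ℝ) (t : ℝ) : ℝ[X] :=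
  ∑ m ∈ Finset.range 3,
    Polynomial.C (iteratedDeriv m F t / (m.factorial : ℝ)) * (Polynomial.X - Polynomial.C t) ^ m

end

/-- A map on `[0, ∞)^ι` that depends only on the coordinates in `S`. -/
def DependsOnlyOn {ι X : Type*} (S : Finset ι) (Ξ : (ι → ℝ≥0) → X) : Prop :=
  ∀ f g : ι → ℝ≥0, (∀ i ∈ S, f i = g i) → Ξ f = Ξ g

/-- A map on `[0, ∞)^ι` has depth `D` if it depends only on at most `D` of the coordinates. -/
def HasDepth {ι X : Type*} (D : ℕ) (Ξ : (ι → ℝ≥0) → X) : Prop :=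
  ∃ S : Finset ι, S.card ≤ D ∧ DependsOnlyOn S Ξ

/-! ### A random access machine that works with exact real numbers

The machine has integer registers, real registers, an integer memory and a real memory. A program
uses only the finitely many registers that it names; memory is accessed at computed integer
addresses. Real numbers and integers never mix: in particular there is no rounding of reals. -/

namespace RealRAM

/-- A state of the machine: contents of the integer and real registers, and of the integer and
real memory. -/
structure State where
  ireg : ℕ → ℕ
  rreg : ℕ → ℝ
  imem : ℕ → ℕ
  rmem : ℕ → ℝ

/-- Integer expressions: registers, constants, memory reads, addition, truncated subtraction,
halving. -/
inductive IExp where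
  | reg (k : ℕ)
  | const (n : ℕ)
  | mem (a : IExp)
  | add (a b : IExp)
  | sub (a b : IExp)
  | half (a : IExp)

/-- Real expressions: registers, rational constants, memory reads and the four field operations. -/
inductive RExp where
  | reg (k : ℕ)
  | const (q : ℚ)
  | mem (a : IExp)
  | add (a b : RExp)
  | sub (a b : RExp)
  | mul (a b : RExp)
  | div (a b : RExp)

/-- Tests: comparison of two integers or of two reals. -/
inductive Test where
  | ilt (a b : IExp)
  | rlt (a b : RExp)

/-- Programs. -/
inductive Cmd where
  | skip
  | iset (k : ℕ) (a : IExp)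
  | rset (k : ℕ) (a : RExp)
  | istore (addr a : IExp)
  | rstore (addr : IExp) (a : RExp)
  | seq (p q : Cmd)
  | ite (b : Test) (p q : Cmd)
  | loop (b : Test) (p : Cmd)

/-- Value of an integer expression. -/
def IExp.val (σ : State) : IExp → ℕ
  | .reg k => σ.ireg k
  | .const n => n
  | .mem a => σ.imem (a.val σ)
  | .add a b => a.val σ + b.val σ
  | .sub a b => a.val σ - b.val σ
  | .half a => a.val σ / 2

/-- Value of a real expression. A division by zero returns zero. -/
noncomputable def RExp.val (σ : State) : RExp → ℝ
  | .reg k => σ.rreg k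
  | .const q => (q : ℝ)
  | .mem a => σ.rmem (a.val σ)
  | .add a b => a.val σ + b.val σ
  | .sub a b => a.val σ - b.val σ
  | .mul a b => a.val σ * b.val σ
  | .div a b => a.val σ / b.val σ

/-- The outcome of a test. -/
def Test.Holds (σ : State) : Test → Prop
  | .ilt a b => a.val σ < b.val σ
  | .rlt a b => a.val σ < b.val σ

/-- Number of elementary operations needed to evaluate an integer expression; every register
access, constant, memory read and arithmetic operation counts. -/
def IExp.cost : IExp → ℕ
  | .reg _ => 1
  | .const _ => 1
  | .mem a => a.cost + 1
  | .add a b => a.cost + b.cost + 1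
  | .sub a b => a.cost + b.cost + 1
  | .half a => a.cost + 1

/-- Number of elementary operations needed to evaluate a real expression. -/
def RExp.cost : RExp → ℕ
  | .reg _ => 1
  | .const _ => 1
  | .mem a => a.cost + 1
  | .add a b => a.cost + b.cost + 1
  | .sub a b => a.cost + b.cost + 1
  | .mul a b => a.cost + b.cost + 1
  | .div a b => a.cost + b.cost + 1

/-- Number of elementary operations needed to perform a test. -/
def Test.cost : Test → ℕ
  | .ilt a b => a.cost + b.cost + 1
  | .rlt a b => a.cost + b.cost + 1

/-- Write an integer register. -/
def State.setI (σ : State) (k v : ℕ) : State :=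
  { σ with ireg := Function.update σ.ireg k v }

/-- Write a real register. -/
noncomputable def State.setR (σ : State) (k : ℕ) (v : ℝ) : State :=
  { σ with rreg := Function.update σ.rreg k v }

/-- Write a cell of the integer memory. -/
def State.storeI (σ : State) (a v : ℕ) : State :=
  { σ with imem := Function.update σ.imem a v }

/-- Write a cell of the real memory. -/
noncomputable def State.storeR (σ : State) (a : ℕ) (v : ℝ) : State :=
  { σ with rmem := Function.update σ.rmem a v }

/-- `Exec s p σ T τ`: the program `p`, started in the state `σ`, halts in the state `τ` after
exactly `T` elementary operations, and uses at most `s` units of storage: it writes only to memory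
cells with address less than `s`, and every integer that it stores is at most `s` (so that an
integer occupies a machine word of `O(log s)` bits). -/
inductive Exec (s : ℕ) : Cmd → State → ℕ → State → Prop where
  | skip (σ : State) : Exec s .skip σ 1 σ
  | iset (k : ℕ) (a : IExp) (σ : State) (hv : a.val σ ≤ s) :
      Exec s (.iset k a) σ (a.cost + 1) (σ.setI k (a.val σ))
  | rset (k : ℕ) (a : RExp) (σ : State) :
      Exec s (.rset k a) σ (a.cost + 1) (σ.setR k (a.val σ))
  | istore (addr a : IExp) (σ : State) (ha : addr.val σ < s) (hv : a.val σ ≤ s) :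
      Exec s (.istore addr a) σ (addr.cost + a.cost + 1) (σ.storeI (addr.val σ) (a.val σ))
  | rstore (addr : IExp) (a : RExp) (σ : State) (ha : addr.val σ < s) :
      Exec s (.rstore addr a) σ (addr.cost + a.cost + 1) (σ.storeR (addr.val σ) (a.val σ))
  | seq (p q : Cmd) (σ τ υ : State) (T T' : ℕ)
      (hp : Exec s p σ T τ) (hq : Exec s q τ T' υ) : Exec s (.seq p q) σ (T + T') υ
  | ite_pos (b : Test) (p q : Cmd) (σ τ : State) (T : ℕ)
      (hb : b.Holds σ) (hp : Exec s p σ T τ) : Exec s (.ite b p q) σ (b.cost + T) τ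
  | ite_neg (b : Test) (p q : Cmd) (σ τ : State) (T : ℕ)
      (hb : ¬ b.Holds σ) (hq : Exec s q σ T τ) : Exec s (.ite b p q) σ (b.cost + T) τ
  | loop_stop (b : Test) (p : Cmd) (σ : State)
      (hb : ¬ b.Holds σ) : Exec s (.loop b p) σ b.cost σ
  | loop_step (b : Test) (p : Cmd) (σ τ υ : State) (T T' : ℕ)
      (hb : b.Holds σ) (hp : Exec s p σ T τ) (hl : Exec s (.loop b p) τ T' υ) :
      Exec s (.loop b p) σ (b.cost + T + T') υ

/-- Start of the one-time work: integer register `0` holds the number `N` of data points, the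
real memory cells `0, …, N - 1` hold the (unsorted) points, and everything else is zero. -/
noncomputable def initState {N : ℕ} (x : Fin N → ℝ) : State where
  ireg k := if k = 0 then N else 0
  rreg _ := 0
  imem _ := 0
  rmem k := if h : k < N then x ⟨k, h⟩ else 0

/-- Start of a query `t`: the memory is as the one-time work left it, real register `0` holds `t`,
and all other registers are zero. -/
noncomputable def queryState (μ : State) (t : ℝ) : State where
  ireg _ := 0
  rreg k := if k = 0 then t else 0
  imem := μ.imem
  rmem := μ.rmem

/-- An efficient representation: a list of `d` distinct indices out of `0, …, N - 1`, and the `K`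
real constants of the algorithm that computes the represented map from the selected coordinates
(the algorithm is a fixed program `ev` supplied with these constants). -/
structure EffRep (N K : ℕ) where
  d : ℕ
  idx : Fin d → Fin N
  idx_injective : Function.Injective idx
  par : Fin K → ℝ

namespace EffRep

variable {N K : ℕ}

/-- The final state `τ` returns the representation `r`: integer register `0` holds the number of
indices, the next integer registers hold the indices, and the first `K` real registers hold the
constants of the algorithm. -/
def ReturnedBy (r : EffRep N K) (τ : State) : Prop :=
  τ.ireg 0 = r.d ∧ (∀ j : Fin r.d, τ.ireg (j + 1) = r.idx j) ∧ ∀ k : Fin K, τ.rreg k = r.par k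

/-- Start of an evaluation: the machine sees only the constants of the algorithm (in the first `K`
real registers), the number of selected coordinates (in integer register `0`) and the values `z`
of these coordinates (in the real memory). -/
noncomputable def evalState (r : EffRep N K) (z : Fin r.d → ℝ) : State where
  ireg k := if k = 0 then r.d else 0
  rreg k := if h : k < K then r.par ⟨k, h⟩ else 0
  imem _ := 0
  rmem k := if h : k < r.d then z ⟨k, h⟩ else 0

/-- The coordinates selected by `r`, where `e` enumerates the data points. -/
noncomputable def support {E : Finset ℝ} (r : EffRep E.card K) (e : Fin E.card ≃ E) : Finset E :=
  Finset.univ.image fun j => e (r.idx j)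

/-- `r` is an efficient representation of the map `Ξ`, whose values are two-jets at `t`: `Ξ`
depends only on the selected coordinates, of which there are at most `D`; and for every
`f ∈ [0, ∞)^E` in the span of the selected coordinate vectors, the program `ev`, given the
constants in `r` and the selected coordinates of `f`, halts after at most `c` operations with the
derivatives of orders `0, 1, 2` at `t` of the polynomial `Ξ f` in the first three real
registers. -/
def Represents {E : Finset ℝ} (ev : Cmd) (D c : ℕ) (e : Fin E.card ≃ E) (t : ℝ)
    (r : EffRep E.card K) (Ξ : (E → ℝ≥0) → Polynomial.degreeLE ℝ 2) : Prop :=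
  r.d ≤ D ∧ DependsOnlyOn (r.support e) Ξ ∧
    ∀ f : E → ℝ≥0, (∀ a, a ∉ r.support e → f a = 0) →
      ∃ (T : ℕ) (τ : State), T ≤ c ∧
        Exec c ev (r.evalState fun j => (f (e (r.idx j)) : ℝ)) T τ ∧
        ∀ m : Fin 3, τ.rreg m =
          ((Polynomial.derivative^[(m : ℕ)] (Ξ f : ℝ[X])).eval t)

end EffRep

end RealRAM

/-!
The interpolant is explicit. Let `y 0 < ⋯ < y (N - 1)` be the points of `E` and `z i ≥ 0` the values
of `f`. To each node belongs a slope `p i` and the quadratic `z + p h + (p² / 4 z) h² = (2 z + p h)²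
/ (4 z) ≥ 0` in the distance `h` from the node (`quadJet`), which needs no square roots. The
interpolant `F` is the sum of these quadratics times cutoffs that are made of a quintic step and
vanish from the neighbouring nodes on; near `t` only the two nodes next to `t` contribute
(`splineJet_eq`). It interpolates and is nonnegative by construction.

The point is the choice of `p i` (`slopeOf`): it is the difference quotient to the nearest node, or
`0` if the value there exceeds `2 z i`. If `G ≥ 0` is any interpolant with `C²` norm at most `M`,
then `G'² ≤ 4 M G`, and this implies, with no knowledge of `M` in the rule, that `|p i - G' (y i)| ≤
5 M r`, with `r` the distance to the nearest node, and `(p i)² ≤ 10 M z i` (`slopeOf_bounds`). The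
second bound controls each quadratic. The first shows that the quadratics of two nodes at a distance
`d ≤ 1` differ by `O(M d²)` between these nodes, which outweighs the derivatives of the cutoffs, of
size `O(d⁻²)` (`abs_pair_le`). Hence `‖F‖ ≤ 400 M` (`Compatible.abs_splineJet_le`).

Since the slopes use nearest nodes, the jet of `F` at `t` depends only on the values at the two
nodes before `t` and the two nodes after it, the window. Given `t`, the jets of the cutoffs are
constants, so that a straight-line program with two comparisons computes the jet of `F` from the
values in the window.

The one-time work sorts the points by a tournament in a binary tree (`Tournament.sort_ends`): each
of the `N` rounds puts out the winner at the root, removes it from its leaf and replays the `O(log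
N)` matches above this leaf. A query locates `t` by binary search (`Query.searchLoop_ends`) and then
computes the indices in the window, the jets of the cutoffs and the positions of the relevant nodes
in the window (`Query.respond_ends`). Programs without loops are treated as lists of assignments
whose effect is a function on states (`RealRAM.run`); loops are handled by an invariant that is
indexed by a bound for the number of remaining rounds (`RealRAM.Ends.loop`).
-/

namespace NonnegC2

/-! ### Fields of two-jets -/

/-- A field of triples `J t = (F(t), F'(t), F''(t))` coming from a twice continuously differentiable
function `F = J · 0`. -/
structure IsTwoJet (J : ℝ → Fin 3 → ℝ) : Prop where
  deriv_zero : ∀ t, HasDerivAt (fun s => J s 0) (J t 1) t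
  deriv_one : ∀ t, HasDerivAt (fun s => J s 1) (J t 2) t
  continuous_two : Continuous fun s => J s 2

/-- The Leibniz product of two-jets. -/
def jmul (c q : Fin 3 → ℝ) : Fin 3 → ℝ :=
  ![c 0 * q 0, c 1 * q 0 + c 0 * q 1, c 2 * q 0 + 2 * c 1 * q 1 + c 0 * q 2]

@[simp] lemma jmul_apply_zero (c q : Fin 3 → ℝ) : jmul c q 0 = c 0 * q 0 := rfl
@[simp] lemma jmul_apply_one (c q : Fin 3 → ℝ) : jmul c q 1 = c 1 * q 0 + c 0 * q 1 := rfl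
@[simp] lemma jmul_apply_two (c q : Fin 3 → ℝ) :
    jmul c q 2 = c 2 * q 0 + 2 * c 1 * q 1 + c 0 * q 2 := rfl

lemma zero_jmul (q : Fin 3 → ℝ) : jmul 0 q = 0 := by
  ext m; fin_cases m <;> simp [jmul]

lemma jmul_one (c : Fin 3 → ℝ) : jmul c ![1, 0, 0] = c := by
  ext m; fin_cases m <;> simp [jmul]

lemma one_jmul (c : Fin 3 → ℝ) : jmul ![1, 0, 0] c = c := by
  ext m; fin_cases m <;> simp [jmul]

lemma jmul_zero (c : Fin 3 → ℝ) : jmul c 0 = 0 := by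
  ext m; fin_cases m <;> simp [jmul]

namespace IsTwoJet

variable {J K : ℝ → Fin 3 → ℝ}

lemma deriv_eq (hJ : IsTwoJet J) : deriv (fun s => J s 0) = fun s => J s 1 :=
  funext fun t => (hJ.deriv_zero t).deriv

lemma deriv_eq' (hJ : IsTwoJet J) : deriv (fun s => J s 1) = fun s => J s 2 :=
  funext fun t => (hJ.deriv_one t).deriv

lemma iteratedDeriv_eq (hJ : IsTwoJet J) (m : Fin 3) (t : ℝ) :
    iteratedDeriv m (fun s => J s 0) t = J t m := by
  fin_cases m
  · simp
  · simp [iteratedDeriv_one, hJ.deriv_eq]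
  · simp [iteratedDeriv_succ, iteratedDeriv_zero, hJ.deriv_eq, hJ.deriv_eq']

lemma contDiff (hJ : IsTwoJet J) : ContDiff ℝ 2 fun s => J s 0 := by
  have h1 : ContDiff ℝ 1 fun s => J s 1 := by
    rw [contDiff_one_iff_deriv, hJ.deriv_eq']
    exact ⟨fun t => (hJ.deriv_one t).differentiableAt, hJ.continuous_two⟩
  rw [show (2 : WithTop ℕ∞) = 1 + 1 by norm_num, contDiff_succ_iff_deriv, hJ.deriv_eq]
  exact ⟨fun t => (hJ.deriv_zero t).differentiableAt, by simp, h1⟩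

lemma continuous_zero (hJ : IsTwoJet J) : Continuous fun s => J s 0 :=
  continuous_iff_continuousAt.2 fun t => (hJ.deriv_zero t).continuousAt

lemma continuous_one (hJ : IsTwoJet J) : Continuous fun s => J s 1 :=
  continuous_iff_continuousAt.2 fun t => (hJ.deriv_one t).continuousAt

lemma mul (hJ : IsTwoJet J) (hK : IsTwoJet K) : IsTwoJet fun t => jmul (J t) (K t) where
  deriv_zero t := (hJ.deriv_zero t).mul (hK.deriv_zero t)
  deriv_one t := by
    have h := ((hJ.deriv_one t).mul (hK.deriv_zero t)).add
      ((hJ.deriv_zero t).mul (hK.deriv_one t))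
    refine h.congr_deriv ?_
    simp only [jmul_apply_two]; ring
  continuous_two := by
    have := hJ.continuous_zero
    have := hJ.continuous_one
    have := hJ.continuous_two
    have := hK.continuous_zero
    have := hK.continuous_one
    have := hK.continuous_two
    simp only [jmul_apply_two]
    fun_prop

lemma sum {ι : Type*} (s : Finset ι) {J : ι → ℝ → Fin 3 → ℝ} (hJ : ∀ i ∈ s, IsTwoJet (J i)) :
    IsTwoJet fun t => ∑ i ∈ s, J i t where
  deriv_zero t := by
    simpa only [Finset.sum_apply] using HasDerivAt.fun_sum fun i hi => (hJ i hi).deriv_zero t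
  deriv_one t := by
    simpa only [Finset.sum_apply] using HasDerivAt.fun_sum fun i hi => (hJ i hi).deriv_one t
  continuous_two := by
    simpa only [Finset.sum_apply] using continuous_finsetSum s fun i hi => (hJ i hi).continuous_two

end IsTwoJet

/-! ### Cutoffs and nonnegative quadratics -/

/-- The nearest point of `[0, 1]`. -/
noncomputable def clamp (u : ℝ) : ℝ := min (max u 0) 1

lemma clamp_of_nonpos {u : ℝ} (h : u ≤ 0) : clamp u = 0 := by simp [clamp, h]
lemma clamp_of_one_le {u : ℝ} (h : 1 ≤ u) : clamp u = 1 := by simp [clamp, h]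
lemma clamp_of_mem {u : ℝ} (h : 0 ≤ u) (h' : u ≤ 1) : clamp u = u := by simp [clamp, h, h']
lemma clamp_nonneg (u : ℝ) : 0 ≤ clamp u := by simp [clamp]
lemma clamp_le_one (u : ℝ) : clamp u ≤ 1 := by simp [clamp]
lemma continuous_clamp : Continuous clamp := by unfold clamp; fun_prop

/-- A function whose derivative vanishes at `0` and at `1` stays differentiable when its argument is
clamped to `[0, 1]`. -/
lemma hasDerivAt_comp_clamp {f f' : ℝ → ℝ} (hf : ∀ u, HasDerivAt f (f' u) u)
    (hf' : Continuous f') (h0 : f' 0 = 0) (h1 : f' 1 = 0) (u : ℝ) :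
    HasDerivAt (fun v => f (clamp v)) (f' (clamp u)) u := by
  have hfc : Continuous f := continuous_iff_continuousAt.2 fun t => (hf t).continuousAt
  have key : ∀ v, HasDerivAt (fun v => f (max v 0)) (f' (max v 0)) v := by
    refine hasDerivAt_of_hasDerivAt_of_ne' (g := fun v => f' (max v 0)) (x := 0) (fun v hv => ?_)
      (by fun_prop) (by fun_prop)
    rcases lt_or_gt_of_ne hv with h | h
    · have : HasDerivAt (fun _ : ℝ => f 0) 0 v := hasDerivAt_const _ _
      simp only [max_eq_right h.le, h0]
      refine this.congr_of_eventuallyEq ?_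
      filter_upwards [gt_mem_nhds h] with w hw
      rw [max_eq_right hw.le]
    · simp only [max_eq_left h.le]
      refine (hf v).congr_of_eventuallyEq ?_
      filter_upwards [lt_mem_nhds h] with w hw
      rw [max_eq_left hw.le]
  refine hasDerivAt_of_hasDerivAt_of_ne' (g := fun v => f' (clamp v)) (x := 1) (fun v hv => ?_)
      (by have := continuous_clamp; fun_prop) (by have := continuous_clamp; fun_prop) u
  rcases lt_or_gt_of_ne hv with h | h
  · have e : ∀ w < (1 : ℝ), clamp w = max w 0 := fun w hw => by simp [clamp, hw.le]
    rw [e v h]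
    refine (key v).congr_of_eventuallyEq ?_
    filter_upwards [gt_mem_nhds h] with w hw
    rw [e w hw]
  · have : HasDerivAt (fun _ : ℝ => f 1) 0 v := hasDerivAt_const _ _
    simp only [clamp_of_one_le h.le, h1]
    refine this.congr_of_eventuallyEq ?_
    filter_upwards [lt_mem_nhds h] with w hw
    rw [clamp_of_one_le hw.le]

/-- The quintic `6 v⁵ - 15 v⁴ + 10 v³`, which rises from `0` at `0` to `1` at `1` with vanishing
first and second derivatives at both ends, and its first two derivatives. -/
def quintic (v : ℝ) : Fin 3 → ℝ :=
  ![v * v * v * (10 - 15 * v + 6 * (v * v)), 30 * (v * v) * ((1 - v) * (1 - v)),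
    60 * v * (1 - v) * (1 - 2 * v)]

/-- The jet of the smooth step, equal to `0` on `(-∞, 0]` and to `1` on `[1, ∞)`. -/
noncomputable def step (u : ℝ) : Fin 3 → ℝ := quintic (clamp u)

lemma isTwoJet_step : IsTwoJet step where
  deriv_zero := hasDerivAt_comp_clamp (f := fun v => quintic v 0) (f' := fun v => quintic v 1)
    (fun u => by
      have h : HasDerivAt (fun v : ℝ => 6 * v ^ 5 - 15 * v ^ 4 + 10 * v ^ 3)
          (6 * (5 * u ^ 4) - 15 * (4 * u ^ 3) + 10 * (3 * u ^ 2)) u := by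
        have h5 := (hasDerivAt_pow 5 u).const_mul 6
        have h4 := (hasDerivAt_pow 4 u).const_mul 15
        have h3 := (hasDerivAt_pow 3 u).const_mul 10
        exact (h5.sub h4).add h3
      have e : (fun v => quintic v 0) = fun v : ℝ => 6 * v ^ 5 - 15 * v ^ 4 + 10 * v ^ 3 := by
        funext v; simp only [quintic, Matrix.cons_val_zero]; ring
      rw [e]
      refine h.congr_deriv ?_
      simp only [quintic, Matrix.cons_val_one, Matrix.cons_val_zero]; ring)
    (by simp only [quintic, Matrix.cons_val_one, Matrix.cons_val_zero]; fun_prop)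
    (by simp [quintic]) (by simp [quintic])
  deriv_one := hasDerivAt_comp_clamp (f := fun v => quintic v 1) (f' := fun v => quintic v 2)
    (fun u => by
      have h : HasDerivAt (fun v : ℝ => 30 * v ^ 4 - 60 * v ^ 3 + 30 * v ^ 2)
          (30 * (4 * u ^ 3) - 60 * (3 * u ^ 2) + 30 * (2 * u ^ 1)) u := by
        have h5 := (hasDerivAt_pow 4 u).const_mul 30
        have h4 := (hasDerivAt_pow 3 u).const_mul 60
        have h3 := (hasDerivAt_pow 2 u).const_mul 30
        exact (h5.sub h4).add h3
      have e : (fun v => quintic v 1) = fun v : ℝ => 30 * v ^ 4 - 60 * v ^ 3 + 30 * v ^ 2 := by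
        funext v; simp only [quintic, Matrix.cons_val_one, Matrix.cons_val_zero]; ring
      rw [e]
      refine h.congr_deriv ?_
      simp only [quintic, Matrix.cons_val]; ring)
    (by simp only [quintic, Matrix.cons_val]; fun_prop)
    (by simp [quintic]) (by simp [quintic])
  continuous_two := by
    have := continuous_clamp
    simp only [step, quintic, Matrix.cons_val]
    fun_prop

lemma step_of_nonpos {u : ℝ} (h : u ≤ 0) : step u = 0 := by
  ext m; fin_cases m <;> simp [step, quintic, clamp_of_nonpos h]

lemma step_of_one_le {u : ℝ} (h : 1 ≤ u) : step u = ![1, 0, 0] := by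
  ext m; fin_cases m <;> simp [step, quintic, clamp_of_one_le h]; norm_num

lemma step_zero_mem (u : ℝ) : step u 0 ∈ Set.Icc (0 : ℝ) 1 := by
  have h0 := clamp_nonneg u
  have h1 := clamp_le_one u
  simp only [step, quintic, Matrix.cons_val_zero, Set.mem_Icc]
  set v := clamp u
  constructor
  · have : 0 ≤ 10 - 15 * v + 6 * (v * v) := by nlinarith [sq_nonneg (v - 1)]
    positivity
  · have : 0 ≤ (1 - v) ^ 3 * (1 + 3 * v + 6 * v ^ 2) :=
      mul_nonneg (pow_nonneg (by linarith) 3) (by positivity)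
    nlinarith [this]

lemma abs_step_one_le (u : ℝ) : |step u 1| ≤ 2 := by
  have h0 := clamp_nonneg u
  have h1 := clamp_le_one u
  simp only [step, quintic, Matrix.cons_val]
  set v := clamp u
  have hw : 0 ≤ v * (1 - v) := mul_nonneg h0 (by linarith)
  have hw' : v * (1 - v) ≤ 1 / 4 := by nlinarith [sq_nonneg (v - 1 / 2)]
  rw [abs_of_nonneg (by positivity)]
  nlinarith

lemma abs_step_two_le (u : ℝ) : |step u 2| ≤ 15 := by
  have h0 := clamp_nonneg u
  have h1 := clamp_le_one u
  simp only [step, quintic, Matrix.cons_val]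
  set v := clamp u
  have hw : 0 ≤ v * (1 - v) := mul_nonneg h0 (by linarith)
  have hw' : v * (1 - v) ≤ 1 / 4 := by nlinarith [sq_nonneg (v - 1 / 2)]
  rw [abs_le]
  constructor <;> nlinarith

/-- The step is antisymmetric about `1 / 2`. -/
lemma step_one_sub {u : ℝ} (h0 : 0 ≤ u) (h1 : u ≤ 1) :
    step (1 - u) = ![1 - step u 0, step u 1, -step u 2] := by
  have e1 : clamp u = u := clamp_of_mem h0 h1
  have e2 : clamp (1 - u) = 1 - u := clamp_of_mem (by linarith) (by linarith)
  ext m; fin_cases m <;> simp [step, quintic, e1, e2] <;> ring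

/-- The jet at distance `h` from a node of the cutoff that equals `1` on the side of the node where
`σ h ≤ 0` and drops to `0` over the length `g` on the other side; here `σ = ± 1`. -/
noncomputable def cutJet (σ g h : ℝ) : Fin 3 → ℝ :=
  ![1 - step (σ * h / g) 0, -(σ * step (σ * h / g) 1 / g), -(step (σ * h / g) 2 / (g * g))]

lemma isTwoJet_cutJet {σ : ℝ} (hσ : σ * σ = 1) (g a : ℝ) :
    IsTwoJet fun t => cutJet σ g (t - a) := by
  have hl : ∀ t : ℝ, HasDerivAt (fun t => σ * (t - a) / g) (σ / g) t := fun t => by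
    simpa using (((hasDerivAt_id t).sub_const a).const_mul σ).div_const g
  refine ⟨fun t => ?_, fun t => ?_, ?_⟩
  · refine (((isTwoJet_step.deriv_zero _).comp t (hl t)).const_sub 1).congr_deriv ?_
    simp only [cutJet, Matrix.cons_val]; ring
  · refine ((((isTwoJet_step.deriv_one _).comp t (hl t)).const_mul σ).div_const g).neg.congr_deriv
      ?_
    have : ∀ x : ℝ, σ * (x * (σ / g)) / g = (σ * σ) * (x / (g * g)) := fun x => by
      rw [div_mul_eq_div_div]; ring
    simp only [cutJet, Matrix.cons_val, this, hσ, one_mul]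
  · have := isTwoJet_step.continuous_two
    have : Continuous fun t => step (σ * (t - a) / g) 2 := this.comp (by fun_prop)
    simp only [cutJet, Matrix.cons_val]
    exact (this.div_const _).neg

lemma cutJet_of_nonpos {σ g h : ℝ} (hg : 0 ≤ g) (hh : σ * h ≤ 0) : cutJet σ g h = ![1, 0, 0] := by
  have : σ * h / g ≤ 0 := div_nonpos_of_nonpos_of_nonneg hh hg
  simp [cutJet, step_of_nonpos this]

lemma cutJet_of_le {σ g h : ℝ} (hg : 0 < g) (hh : g ≤ σ * h) : cutJet σ g h = 0 := by
  have : 1 ≤ σ * h / g := by rwa [one_le_div hg]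
  ext m; fin_cases m <;> simp [cutJet, step_of_one_le this]

lemma cutJet_zero_mem (σ g h : ℝ) : cutJet σ g h 0 ∈ Set.Icc (0 : ℝ) 1 := by
  have := step_zero_mem (σ * h / g)
  simp only [Set.mem_Icc, cutJet, Matrix.cons_val] at *
  constructor <;> linarith

/-- The jet at distance `h` from a node of the quadratic polynomial with value `z` and slope `p` at
the node whose double root makes it nonnegative. For `z = 0`, division by zero gives leading
coefficient `0`. -/
noncomputable def quadJet (z p h : ℝ) : Fin 3 → ℝ :=
  ![z + p * h + p * p / (4 * z) * (h * h), p + 2 * (p * p / (4 * z)) * h, 2 * (p * p / (4 * z))]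

lemma isTwoJet_quadJet (z p a : ℝ) : IsTwoJet fun t => quadJet z p (t - a) := by
  refine ⟨fun t => ?_, fun t => ?_, ?_⟩
  · have h1 : HasDerivAt (fun t : ℝ => t - a) 1 t := (hasDerivAt_id t).sub_const a
    have h2 := ((h1.const_mul p).const_add z).add ((h1.mul h1).const_mul (p * p / (4 * z)))
    refine h2.congr_deriv ?_
    simp only [quadJet, Matrix.cons_val]; ring
  · have h1 : HasDerivAt (fun t : ℝ => t - a) 1 t := (hasDerivAt_id t).sub_const a
    refine ((h1.const_mul (2 * (p * p / (4 * z)))).const_add p).congr_deriv ?_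
    simp only [quadJet, Matrix.cons_val]; ring
  · simp only [quadJet, Matrix.cons_val]; fun_prop

lemma quadJet_zero_nonneg {z p : ℝ} (hz : 0 ≤ z) (hp : z = 0 → p = 0) (h : ℝ) :
    0 ≤ quadJet z p h 0 := by
  simp only [quadJet, Matrix.cons_val]
  rcases hz.eq_or_lt with h0 | h0
  · simp [hp h0.symm, h0.symm]
  · have : z + p * h + p * p / (4 * z) * (h * h) = (2 * z + p * h) ^ 2 / (4 * z) := by
      field_simp; ring
    rw [this]; positivity

end NonnegC2

namespace NonnegC2

/-! ### The interpolant -/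

/-- Distance from the node in position `k - 1` to the node in position `k`, truncated at `1`; it is
`1` before the first and after the last node. -/
noncomputable def gap (N : ℕ) (y : ℕ → ℝ) (k : ℕ) : ℝ :=
  if 0 < k ∧ k < N then min (y k - y (k - 1)) 1 else 1

/-- Position of the node nearest to the node in position `i`. If there is only one node, this is the
node itself. -/
noncomputable def nearest (N : ℕ) (y : ℕ → ℝ) (i : ℕ) : ℕ :=
  if i + 1 < N ∧ (i = 0 ∨ y (i + 1) - y i < y i - y (i - 1)) then i + 1 else i - 1

/-- The slope prescribed at a node with value `z`: the difference quotient to the nearest node,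
which has value `z'` and lies at signed distance `1 / w`, unless `z'` is so much larger than `z`
that this slope is incompatible with nonnegativity. -/
noncomputable def slopeOf (z z' w : ℝ) : ℝ := if 2 * z < z' then 0 else (z' - z) * w

/-- The slope prescribed at the node in position `i`. -/
noncomputable def slope (N : ℕ) (y z : ℕ → ℝ) (i : ℕ) : ℝ :=
  slopeOf (z i) (z (nearest N y i)) (1 / (y (nearest N y i) - y i))

/-- Jet at `t` of the nonnegative quadratic attached to the node in position `i`, times its cutoffs
to the right and to the left. -/
noncomputable def nodeJet (N : ℕ) (y z : ℕ → ℝ) (i : ℕ) (t : ℝ) : Fin 3 → ℝ :=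
  jmul (jmul (cutJet 1 (gap N y (i + 1)) (t - y i)) (cutJet (-1) (gap N y i) (t - y i)))
    (quadJet (z i) (slope N y z i) (t - y i))

/-- Jet at `t` of the interpolant of the values `z` at the nodes `y 0 < ⋯ < y (N - 1)`. -/
noncomputable def splineJet (N : ℕ) (y z : ℕ → ℝ) (t : ℝ) : Fin 3 → ℝ :=
  ∑ i ∈ Finset.range N, nodeJet N y z i t

/-- The contribution of the node in position `i` to the jet at a point on the side `σ = ± 1` of it,
where `g` is the cutoff length on that side. -/
noncomputable def sideJet (N : ℕ) (y z : ℕ → ℝ) (σ g : ℝ) (i : ℕ) (t : ℝ) : Fin 3 → ℝ :=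
  jmul (cutJet σ g (t - y i)) (quadJet (z i) (slope N y z i) (t - y i))

lemma isTwoJet_splineJet (N : ℕ) (y z : ℕ → ℝ) : IsTwoJet (splineJet N y z) :=
  IsTwoJet.sum _ fun i _ => ((isTwoJet_cutJet (by norm_num) _ _).mul
    (isTwoJet_cutJet (by norm_num) _ _)).mul (isTwoJet_quadJet _ _ _)

section

variable {N : ℕ} {y z : ℕ → ℝ}

lemma gap_pos (hy : ∀ i j, i < j → j < N → y i < y j) (k : ℕ) : 0 < gap N y k := by
  unfold gap
  split_ifs with h
  · have := hy (k - 1) k (by omega) h.2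
    exact lt_min (by linarith) one_pos
  · exact one_pos

lemma slope_eq_zero (hz : ∀ i, 0 ≤ z i) {i : ℕ} (h : z i = 0) : slope N y z i = 0 := by
  unfold slope slopeOf
  split_ifs with h'
  · rfl
  · have h1 := hz (nearest N y i)
    have : z (nearest N y i) = 0 := by linarith
    simp [this, h]

lemma splineJet_zero_nonneg (hz : ∀ i, 0 ≤ z i) (t : ℝ) : 0 ≤ splineJet N y z t 0 := by
  rw [splineJet, Finset.sum_apply]
  refine Finset.sum_nonneg fun i _ => ?_
  simp only [nodeJet, jmul_apply_zero]
  exact mul_nonneg (mul_nonneg (cutJet_zero_mem _ _ _).1 (cutJet_zero_mem _ _ _).1)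
    (quadJet_zero_nonneg (hz i) (slope_eq_zero hz) _)

lemma nodeJet_eq_zero_of_succ_le (hy : ∀ i j, i < j → j < N → y i < y j) {i : ℕ} {t : ℝ}
    (hi : i + 1 < N) (ht : y (i + 1) ≤ t) : nodeJet N y z i t = 0 := by
  have h : gap N y (i + 1) ≤ 1 * (t - y i) := by
    rw [gap, if_pos ⟨by omega, hi⟩, Nat.add_sub_cancel]
    exact (min_le_left _ _).trans (by linarith)
  rw [nodeJet, cutJet_of_le (gap_pos hy _) h, zero_jmul, zero_jmul]

lemma nodeJet_eq_zero_of_le_pred (hy : ∀ i j, i < j → j < N → y i < y j) {i : ℕ} {t : ℝ}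
    (h0 : 0 < i) (hi : i < N) (ht : t ≤ y (i - 1)) : nodeJet N y z i t = 0 := by
  have h : gap N y i ≤ -1 * (t - y i) := by
    rw [gap, if_pos ⟨h0, hi⟩]
    exact (min_le_left _ _).trans (by linarith)
  rw [nodeJet, cutJet_of_le (σ := -1) (gap_pos hy _) h, jmul_zero, zero_jmul]

lemma nodeJet_of_le (hy : ∀ i j, i < j → j < N → y i < y j) {i : ℕ} {t : ℝ} (h : y i ≤ t) :
    nodeJet N y z i t = sideJet N y z 1 (gap N y (i + 1)) i t := by
  rw [nodeJet, sideJet, cutJet_of_nonpos (σ := -1) (gap_pos hy _).le (by linarith), jmul_one]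

lemma nodeJet_of_ge (hy : ∀ i j, i < j → j < N → y i < y j) {i : ℕ} {t : ℝ} (h : t ≤ y i) :
    nodeJet N y z i t = sideJet N y z (-1) (gap N y i) i t := by
  rw [nodeJet, sideJet, cutJet_of_nonpos (σ := 1) (gap_pos hy _).le (by linarith), one_jmul]

/-- Only the two nodes next to `t` contribute to the jet at `t`. -/
lemma splineJet_eq (hy : ∀ i j, i < j → j < N → y i < y j) {k : ℕ} {t : ℝ} (hk : k ≤ N)
    (hle : ∀ i < k, y i ≤ t) (hlt : ∀ i, k ≤ i → i < N → t < y i) :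
    splineJet N y z t = (if 0 < k then sideJet N y z 1 (gap N y k) (k - 1) t else 0) +
      if k < N then sideJet N y z (-1) (gap N y k) k t else 0 := by
  have hleft : ∑ i ∈ Finset.range k, nodeJet N y z i t =
      if 0 < k then sideJet N y z 1 (gap N y k) (k - 1) t else 0 := by
    split_ifs with h
    · obtain ⟨l, rfl⟩ : ∃ l, k = l + 1 := ⟨k - 1, by omega⟩
      rw [Finset.sum_range_succ, Finset.sum_eq_zero, zero_add, Nat.add_sub_cancel,
        nodeJet_of_le hy (hle l (by omega))]
      intro i hi
      rw [Finset.mem_range] at hi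
      exact nodeJet_eq_zero_of_succ_le hy (by omega) (hle _ (by omega))
    · rw [show k = 0 by omega]; simp
  have hright : ∑ i ∈ Finset.Ico k N, nodeJet N y z i t =
      if k < N then sideJet N y z (-1) (gap N y k) k t else 0 := by
    split_ifs with h
    · rw [Finset.sum_eq_sum_Ico_succ_bot h, Finset.sum_eq_zero, add_zero,
        nodeJet_of_ge hy (hlt k le_rfl h).le]
      intro i hi
      rw [Finset.mem_Ico] at hi
      exact nodeJet_eq_zero_of_le_pred hy (by omega) hi.2 (hlt _ (by omega) (by omega)).le
    · rw [Finset.Ico_eq_empty (by omega), Finset.sum_empty]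
  rw [splineJet, ← Finset.sum_range_add_sum_Ico _ hk, hleft, hright]

/-- The position of `t` among the nodes. -/
lemma exists_position (hy : ∀ i j, i < j → j < N → y i < y j) (t : ℝ) :
    ∃ k ≤ N, (∀ i < k, y i ≤ t) ∧ ∀ i, k ≤ i → i < N → t < y i := by
  classical
  have hex : ∃ k, N ≤ k ∨ t < y k := ⟨N, Or.inl le_rfl⟩
  refine ⟨Nat.find hex, Nat.find_min' hex (Or.inl le_rfl), fun i hi => ?_, fun i hi hN => ?_⟩
  · have := Nat.find_min hex hi
    push Not at this
    exact this.2
  · rcases Nat.find_spec hex with h | h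
    · omega
    · rcases hi.eq_or_lt with e | e
      · rwa [← e]
      · exact h.trans (hy _ _ e hN)

lemma splineJet_node (hy : ∀ i j, i < j → j < N → y i < y j) {i : ℕ} (hi : i < N) :
    splineJet N y z (y i) 0 = z i := by
  have hmono : ∀ j ≤ i, y j ≤ y i := fun j hj => by
    rcases hj.eq_or_lt with e | e
    · rw [e]
    · exact (hy _ _ e hi).le
  rw [splineJet_eq (k := i + 1) hy (by omega) (fun j hj => hmono j (by omega))
    (fun j hj hN => hy _ _ (by omega) hN), if_pos (by omega), Nat.add_sub_cancel, Pi.add_apply]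
  have h2 : (if i + 1 < N then sideJet N y z (-1) (gap N y (i + 1)) (i + 1) (y i) else 0) = 0 := by
    split_ifs with h
    · rw [sideJet, cutJet_of_le (gap_pos hy _), zero_jmul]
      rw [gap, if_pos ⟨by omega, h⟩, Nat.add_sub_cancel]
      exact (min_le_left _ _).trans (by linarith)
    · rfl
  rw [h2, sideJet, sub_self, cutJet_of_nonpos (gap_pos hy _).le (by simp), one_jmul]
  simp [quadJet]

variable {k : ℕ} {t : ℝ} {y' z' : ℕ → ℝ}

/-- The window contains the nodes next to the query point and their nearest nodes. -/
lemma nearest_mem_window {i : ℕ} (hi : i + 1 = k ∨ i = k) (hiN : i < N) :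
    k - 2 ≤ nearest N y i ∧ nearest N y i < min (k + 2) N := by
  unfold nearest
  split_ifs with h <;> omega

lemma sideJet_congr {sg g : ℝ} {i : ℕ} (h1 : z i = z' i)
    (h2 : z (nearest N y i) = z' (nearest N y i)) :
    sideJet N y z sg g i t = sideJet N y z' sg g i t := by
  rw [sideJet, sideJet, slope, slope, h1, h2]

/-- The jet at a point depends only on the values in the window. -/
lemma splineJet_congr_window (hy : ∀ i j, i < j → j < N → y i < y j) (hk : k ≤ N)
    (hle : ∀ i < k, y i ≤ t) (hlt : ∀ i, k ≤ i → i < N → t < y i)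
    (hz : ∀ j < min (k + 2) N - (k - 2), z (k - 2 + j) = z' (k - 2 + j)) :
    splineJet N y z t = splineJet N y z' t := by
  have hz' : ∀ i, k - 2 ≤ i → i < min (k + 2) N → z i = z' i := fun i h1 h2 => by
    have := hz (i - (k - 2)) (by omega)
    rwa [Nat.add_sub_cancel' h1] at this
  rw [splineJet_eq hy hk hle hlt, splineJet_eq hy hk hle hlt]
  congr 1
  · split_ifs with h
    · obtain ⟨w1, w2⟩ := nearest_mem_window (k := k) (y := y) (N := N) (i := k - 1)
        (by omega) (by omega)
      exact sideJet_congr (hz' _ (by omega) (by omega)) (hz' _ w1 w2)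
    · rfl
  · split_ifs with h
    · obtain ⟨w1, w2⟩ := nearest_mem_window (k := k) (y := y) (N := N) (i := k)
        (by omega) (by omega)
      exact sideJet_congr (hz' _ (by omega) (by omega)) (hz' _ w1 w2)
    · rfl

lemma splineJet_congr_nodes (hy : ∀ i < N, y i = y' i) (z : ℕ → ℝ) (t : ℝ) :
    splineJet N y z t = splineJet N y' z t := by
  have hgap : ∀ i, gap N y i = gap N y' i := fun i => by
    unfold gap
    split_ifs with h
    · rw [hy i h.2, hy (i - 1) (by omega)]
    · rfl
  refine Finset.sum_congr rfl fun i hi => ?_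
  rw [Finset.mem_range] at hi
  have hn : nearest N y i = nearest N y' i := by
    unfold nearest
    by_cases h : i + 1 < N
    · rw [hy i hi, hy (i + 1) h, hy (i - 1) (by omega)]
    · simp [h]
  have hnN : nearest N y' i < N := by
    unfold nearest; split_ifs with h <;> omega
  rw [nodeJet, nodeJet, hgap, hgap, hy i hi, slope, slope, hn, hy _ hnN, hy i hi]

/-! ### Norm estimates -/

/-- The conditions on values `z` and slopes `g` at the nodes that hold for the values and the slopes
of a nonnegative function with `C²` norm at most `M`. -/
structure Compatible (M : ℝ) (N : ℕ) (y z g : ℕ → ℝ) : Prop where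
  val_le : ∀ i < N, z i ≤ M
  slope_sq_le : ∀ i < N, g i * g i ≤ 4 * (M * z i)
  taylor : ∀ i < N, ∀ j < N, |z j - z i - g i * (y j - y i)| ≤ M * ((y j - y i) * (y j - y i))
  slope_sub : ∀ i < N, ∀ j < N, |g j - g i| ≤ M * |y j - y i|

/-- The slope rule loses only a constant: if the difference quotient is used, then the size of the
value controls it; if not, then the value is so small that the true slope is comparable to the
distance to the nearest node. -/
lemma slopeOf_bounds {M a b g D : ℝ} (hM : 0 ≤ M) (ha : 0 ≤ a) (hb : 0 ≤ b) (hD : D ≠ 0)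
    (hg : g * g ≤ 4 * (M * a)) (ht : |b - a - g * D| ≤ M * (D * D)) :
    |slopeOf a b (1 / D) - g| ≤ 5 * (M * |D|) ∧
      slopeOf a b (1 / D) * slopeOf a b (1 / D) ≤ 10 * (M * a) := by
  have hr : 0 < |D| := abs_pos.2 hD
  have hrr : |D| * |D| = D * D := abs_mul_abs_self D
  have hMD : 0 ≤ M * (D * D) := mul_nonneg hM (mul_self_nonneg _)
  have ht' := abs_le.1 ht
  unfold slopeOf
  split_ifs with h
  · refine ⟨?_, by simpa using mul_nonneg hM ha⟩
    rw [zero_sub, abs_neg]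
    set G := |g| * |D| with hG
    have hG0 : 0 ≤ G := by positivity
    have hgD : |g * D| = G := abs_mul _ _
    have h1 : a ≤ G + M * (D * D) := by
      have := le_abs_self (g * D)
      linarith
    have h2 : G * G ≤ 4 * (M * (D * D)) * (G + M * (D * D)) := by
      have e : G * G = (g * g) * (D * D) := by
        rw [hG, ← hrr, ← abs_mul_abs_self g]; ring
      calc G * G = (g * g) * (D * D) := e
        _ ≤ 4 * (M * a) * (D * D) := mul_le_mul_of_nonneg_right hg (mul_self_nonneg _)
        _ = 4 * (M * (D * D)) * a := by ring
        _ ≤ _ := mul_le_mul_of_nonneg_left h1 (by linarith)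
    have h3 : G ≤ 5 * (M * (D * D)) := by
      by_contra! hc
      nlinarith
    have h4 : |g| * |D| ≤ 5 * (M * |D|) * |D| := by
      rw [← hG]; calc G ≤ _ := h3
        _ = _ := by rw [← hrr]; ring
    exact le_of_mul_le_mul_right h4 hr
  · push Not at h
    set L := (b - a) * (1 / D) with hL
    have hLD : L * D = b - a := by rw [hL]; field_simp
    have h1 : |L - g| ≤ M * |D| := by
      have : |L - g| * |D| ≤ M * |D| * |D| := by
        rw [← abs_mul, sub_mul, hLD, mul_assoc, hrr]; exact ht
      exact le_of_mul_le_mul_right this hr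
    refine ⟨h1.trans (by nlinarith [mul_nonneg hM hr.le]), ?_⟩
    rcases le_total (M * (D * D)) a with hc | hc
    · have h5 : (L - g) * (L - g) ≤ M * a := by
        rw [← abs_mul_abs_self]
        calc |L - g| * |L - g| ≤ (M * |D|) * (M * |D|) :=
              mul_le_mul h1 h1 (abs_nonneg _) (mul_nonneg hM hr.le)
          _ = M * (M * (D * D)) := by rw [← hrr]; ring
          _ ≤ M * a := mul_le_mul_of_nonneg_left hc hM
      nlinarith [mul_self_nonneg (L - 2 * g)]
    · have hDD : 0 < D * D := mul_self_pos.2 hD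
      have h6 : (L * L) * (D * D) ≤ (M * a) * (D * D) := by
        have e : (L * L) * (D * D) = (b - a) * (b - a) := by rw [← hLD]; ring
        rw [e]
        have : (b - a) * (b - a) ≤ a * a := abs_le_iff_mul_self_le.1 (by
          rw [abs_of_nonneg ha, abs_le]; constructor <;> linarith)
        nlinarith
      have := le_of_mul_le_mul_right h6 hDD
      have := mul_nonneg hM ha
      linarith

lemma quad_coeff_bounds {M z p : ℝ} (hM : 0 ≤ M) (hz : 0 ≤ z) (hp : p * p ≤ 10 * (M * z)) :
    0 ≤ p * p / (4 * z) ∧ p * p / (4 * z) ≤ 3 * M := by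
  rcases hz.eq_or_lt with h | h
  · simp [← h, hM]
  · refine ⟨div_nonneg (mul_self_nonneg _) (by linarith), ?_⟩
    rw [div_le_iff₀ (by positivity)]
    nlinarith [mul_nonneg hM hz]

lemma abs_le_of_mul_self_le {M z p : ℝ} (hM : 0 ≤ M) (hz : z ≤ M) (hp : p * p ≤ 10 * (M * z)) :
    |p| ≤ 4 * M := by
  have : p * p ≤ (4 * M) * (4 * M) := by nlinarith [mul_le_mul_of_nonneg_left hz hM]
  rw [← abs_of_nonneg (by linarith : 0 ≤ 4 * M)]
  exact abs_le_iff_mul_self_le.2 this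

lemma quadJet_bounds {M z p h : ℝ} (hz : 0 ≤ z) (hzM : z ≤ M) (hp : p * p ≤ 10 * (M * z))
    (hh : |h| ≤ 1) :
    |quadJet z p h 0| ≤ 8 * M ∧ |quadJet z p h 1| ≤ 10 * M ∧ |quadJet z p h 2| ≤ 6 * M := by
  have hM : 0 ≤ M := hz.trans hzM
  have h1 := abs_le_of_mul_self_le hM hzM hp
  obtain ⟨h2, h3⟩ := quad_coeff_bounds hM hz hp
  simp only [quadJet, Matrix.cons_val]
  set q := p * p / (4 * z)
  have hph : |p * h| ≤ 4 * M := by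
    rw [abs_mul]
    calc |p| * |h| ≤ (4 * M) * 1 := mul_le_mul h1 hh (abs_nonneg _) (by linarith)
      _ = _ := mul_one _
  have hqh : |q * h| ≤ 3 * M := by
    rw [abs_mul, abs_of_nonneg h2]
    calc q * |h| ≤ (3 * M) * 1 := mul_le_mul h3 hh (abs_nonneg _) (by linarith)
      _ = _ := mul_one _
  have hqhh : |q * (h * h)| ≤ 3 * M := by
    rw [← mul_assoc, abs_mul]
    calc |q * h| * |h| ≤ (3 * M) * 1 := mul_le_mul hqh hh (abs_nonneg _) (by linarith)
      _ = _ := mul_one _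
  rw [abs_le] at hph hqh hqhh h1
  refine ⟨?_, ?_, ?_⟩ <;> rw [abs_le] <;> constructor <;> linarith

lemma abs_mul_le_mul {c q A B : ℝ} (hc : |c| ≤ A) (hq : |q| ≤ B) : |c * q| ≤ A * B := by
  rw [abs_mul]; exact mul_le_mul hc hq (abs_nonneg _) ((abs_nonneg _).trans hc)

/-- Bound for the contribution of a node when the next node on that side is at distance at least
`1`. -/
lemma abs_side_le {M σ z p h : ℝ} (hσ : |σ| = 1) (hz : 0 ≤ z) (hzM : z ≤ M)
    (hp : p * p ≤ 10 * (M * z)) (hh : 0 ≤ σ * h) (m : Fin 3) :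
    |jmul (cutJet σ 1 h) (quadJet z p h) m| ≤ 200 * M := by
  have hM : 0 ≤ M := hz.trans hzM
  rcases le_total 1 (σ * h) with h1 | h1
  · rw [cutJet_of_le one_pos h1, zero_jmul]; simpa using hM
  have habs : |h| ≤ 1 := by
    have : |σ * h| = |h| := by rw [abs_mul, hσ, one_mul]
    rw [← this, abs_of_nonneg hh]; exact h1
  obtain ⟨q0, q1, q2⟩ := quadJet_bounds hz hzM hp habs
  have c0 : |cutJet σ 1 h 0| ≤ 1 := by
    have := cutJet_zero_mem σ 1 h
    rw [abs_of_nonneg this.1]; exact this.2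
  have c1 : |cutJet σ 1 h 1| ≤ 2 := by
    simp only [cutJet, Matrix.cons_val, abs_neg, div_one, abs_mul, hσ, one_mul]
    exact abs_step_one_le _
  have c2 : |cutJet σ 1 h 2| ≤ 15 := by
    simp only [cutJet, Matrix.cons_val, abs_neg, div_one, mul_one]
    exact abs_step_two_le _
  fin_cases m
  · have := abs_mul_le_mul c0 q0
    simp only [Fin.zero_eta, jmul_apply_zero]; linarith
  · have e1 := abs_mul_le_mul c1 q0
    have e2 := abs_mul_le_mul c0 q1
    simp only [Fin.mk_one, jmul_apply_one]
    have := abs_add_le (cutJet σ 1 h 1 * quadJet z p h 0) (cutJet σ 1 h 0 * quadJet z p h 1)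
    linarith
  · have e1 := abs_mul_le_mul c2 q0
    have e2 := abs_mul_le_mul c1 q1
    have e3 := abs_mul_le_mul c0 q2
    simp only [Fin.reduceFinMk, jmul_apply_two]
    rw [abs_le] at *
    constructor <;> linarith

/-- The quadratics at two nodes at a distance `d` differ by `O(M d²)` between the nodes. -/
lemma abs_quadJet_sub_le {M d h za zb pa pb ga gb : ℝ} (h0 : 0 ≤ h)
    (hhd : h ≤ d) (hM : 0 ≤ M) (hza : 0 ≤ za) (hzb : 0 ≤ zb)
    (hpa : pa * pa ≤ 10 * (M * za)) (hpb : pb * pb ≤ 10 * (M * zb))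
    (hpga : |pa - ga| ≤ 5 * (M * d)) (hpgb : |pb - gb| ≤ 5 * (M * d))
    (hgg : |gb - ga| ≤ M * d) (htay : |zb - za - ga * d| ≤ M * (d * d)) :
    |quadJet zb pb (h - d) 0 - quadJet za pa h 0| ≤ 18 * (M * (d * d)) ∧
      |quadJet zb pb (h - d) 1 - quadJet za pa h 1| ≤ 23 * (M * d) ∧
      |quadJet zb pb (h - d) 2 - quadJet za pa h 2| ≤ 6 * M := by
  obtain ⟨qa0, qa1⟩ := quad_coeff_bounds hM hza hpa
  obtain ⟨qb0, qb1⟩ := quad_coeff_bounds hM hzb hpb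
  simp only [quadJet, Matrix.cons_val]
  generalize pa * pa / (4 * za) = qa at *
  generalize pb * pb / (4 * zb) = qb at *
  have ah : |h| ≤ d := by rwa [abs_of_nonneg h0]
  have ah' : |h - d| ≤ d := by rw [abs_le]; constructor <;> linarith
  have aqa : |qa| ≤ 3 * M := by rwa [abs_of_nonneg qa0]
  have aqb : |qb| ≤ 3 * M := by rwa [abs_of_nonneg qb0]
  have hbg : |pb - ga| ≤ 6 * (M * d) := by
    have e : pb - ga = (pb - gb) + (gb - ga) := by ring
    rw [e]
    exact (abs_add_le _ _).trans (by linarith)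
  have e3 := abs_le.1 hpga
  have e5 := abs_le.1 hbg
  refine ⟨?_, ?_, ?_⟩
  · have e1 := abs_le.1 (abs_mul_le_mul aqa (abs_mul_le_mul ah ah))
    have e2 := abs_le.1 (abs_mul_le_mul aqb (abs_mul_le_mul ah' ah'))
    have e3 := abs_le.1 (abs_mul_le_mul hpga ah)
    have e4 := abs_le.1 (abs_mul_le_mul hbg ah')
    have e5 := abs_le.1 htay
    have e : zb + pb * (h - d) + qb * ((h - d) * (h - d)) - (za + pa * h + qa * (h * h)) =
        (zb - za - ga * d) + (pb - ga) * (h - d) - (pa - ga) * h + qb * ((h - d) * (h - d)) -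
          qa * (h * h) := by ring
    rw [e, abs_le]
    constructor <;> linarith only [e1, e2, e3, e4, e5]
  · have e1 := abs_le.1 (abs_mul_le_mul aqa ah)
    have e2 := abs_le.1 (abs_mul_le_mul aqb ah')
    rw [abs_le]
    constructor <;> linarith only [e1, e2, e3, e5]
  · rw [abs_le]; constructor <;> linarith

/-- Bound for the sum of the contributions of two nodes at a distance `d ≤ 1`. The two cutoffs add
up to `1`, so that their large derivatives meet only the difference of the two quadratics, which is
of order `M d²`. -/
lemma abs_pair_le {M d h za zb pa pb ga gb : ℝ} (hd : 0 < d) (hd1 : d ≤ 1) (h0 : 0 ≤ h)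
    (hhd : h ≤ d) (hza : 0 ≤ za) (hzb : 0 ≤ zb) (hzaM : za ≤ M)
    (hpa : pa * pa ≤ 10 * (M * za)) (hpb : pb * pb ≤ 10 * (M * zb))
    (hpga : |pa - ga| ≤ 5 * (M * d)) (hpgb : |pb - gb| ≤ 5 * (M * d))
    (hgg : |gb - ga| ≤ M * d) (htay : |zb - za - ga * d| ≤ M * (d * d)) (m : Fin 3) :
    |jmul (cutJet 1 d h) (quadJet za pa h) m +
        jmul (cutJet (-1) d (h - d)) (quadJet zb pb (h - d)) m| ≤ 400 * M := by
  have hM : 0 ≤ M := hza.trans hzaM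
  obtain ⟨q0, q1, q2⟩ := quadJet_bounds hza hzaM hpa (h := h)
    (by rw [abs_of_nonneg h0]; linarith)
  obtain ⟨D0, D1, D2⟩ := abs_quadJet_sub_le h0 hhd hM hza hzb hpa hpb hpga hpgb hgg htay
  have hc1 : (1 : ℝ) * h / d = h / d := by rw [one_mul]
  have hc2 : (-1 : ℝ) * (h - d) / d = 1 - h / d := by field_simp; ring
  have hu0 : 0 ≤ h / d := by positivity
  have hu1 : h / d ≤ 1 := by rw [div_le_one hd]; exact hhd
  have s0 := step_zero_mem (h / d)
  have s1 := abs_step_one_le (h / d)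
  have s2 := abs_step_two_le (h / d)
  have hJ := step_one_sub hu0 hu1
  have a0 : |step (h / d) 0| ≤ 1 := by rw [abs_of_nonneg s0.1]; exact s0.2
  have a1 : |step (h / d) 1 / d| ≤ 2 / d := by
    rw [abs_div, abs_of_pos hd]; gcongr
  have a2 : |step (h / d) 2 / (d * d)| ≤ 15 / (d * d) := by
    rw [abs_div, abs_of_pos (mul_pos hd hd)]; gcongr
  have hMdM : M * d ≤ M := mul_le_of_le_one_right hM hd1
  have hMddM : M * (d * d) ≤ M := mul_le_of_le_one_right hM (mul_le_one₀ hd1 hd.le hd1)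
  have h3 : 2 / d * (18 * (M * (d * d))) = 36 * (M * d) := by field_simp; ring
  have h4 : 2 / d * (23 * (M * d)) = 46 * M := by field_simp; ring
  have h5 : 15 / (d * d) * (18 * (M * (d * d))) = 270 * M := by field_simp; ring
  generalize quadJet za pa h = A at *
  generalize quadJet zb pb (h - d) = B at *
  fin_cases m
  · simp only [Fin.zero_eta, jmul_apply_zero, cutJet, Matrix.cons_val, hc1, hc2, hJ]
    generalize step (h / d) = S at *
    have e : (1 - S 0) * A 0 + (1 - (1 - S 0)) * B 0 = A 0 + S 0 * (B 0 - A 0) := by ring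
    rw [e]
    have h1 := abs_mul_le_mul a0 D0
    have := abs_add_le (A 0) (S 0 * (B 0 - A 0))
    linarith only [this, h1, q0, hMddM, hM]
  · simp only [Fin.mk_one, jmul_apply_one, cutJet, Matrix.cons_val, hc1, hc2, hJ]
    generalize step (h / d) = S at *
    have e : -(1 * S 1 / d) * A 0 + (1 - S 0) * A 1 +
        (-(-1 * S 1 / d) * B 0 + (1 - (1 - S 0)) * B 1) =
        A 1 + S 1 / d * (B 0 - A 0) + S 0 * (B 1 - A 1) := by ring
    rw [e]
    have h1 := abs_mul_le_mul a0 D1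
    have h2 := abs_mul_le_mul a1 D0
    rw [h3] at h2
    have := abs_add_three (A 1) (S 1 / d * (B 0 - A 0)) (S 0 * (B 1 - A 1))
    linarith only [this, h1, h2, q1, hMdM, hM]
  · simp only [Fin.reduceFinMk, jmul_apply_two, cutJet, Matrix.cons_val, hc1, hc2, hJ]
    generalize step (h / d) = S at *
    have e : -(S 2 / (d * d)) * A 0 + 2 * -(1 * S 1 / d) * A 1 + (1 - S 0) * A 2 +
        (-(-S 2 / (d * d)) * B 0 + 2 * -(-1 * S 1 / d) * B 1 + (1 - (1 - S 0)) * B 2) =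
        A 2 + S 2 / (d * d) * (B 0 - A 0) +
          (S 1 / d * (B 1 - A 1) + S 1 / d * (B 1 - A 1) + S 0 * (B 2 - A 2)) := by ring
    rw [e]
    have h0 := abs_mul_le_mul a0 D2
    have h1 := abs_mul_le_mul a1 D1
    have h2 := abs_mul_le_mul a2 D0
    rw [h4] at h1
    rw [h5] at h2
    have t1 := abs_add_three (A 2) (S 2 / (d * d) * (B 0 - A 0))
      (S 1 / d * (B 1 - A 1) + S 1 / d * (B 1 - A 1) + S 0 * (B 2 - A 2))
    have t2 := abs_add_three (S 1 / d * (B 1 - A 1)) (S 1 / d * (B 1 - A 1)) (S 0 * (B 2 - A 2))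
    linarith only [t1, t2, h0, h1, h2, q2, hM]

lemma Compatible.slope_bounds {M : ℝ} {g : ℕ → ℝ} (hc : Compatible M N y z g) (hM : 0 ≤ M)
    (hy : ∀ i j, i < j → j < N → y i < y j) (hz : ∀ i, 0 ≤ z i) {i : ℕ} (hi : i < N) :
    |slope N y z i - g i| ≤ 5 * (M * |y (nearest N y i) - y i|) ∨ N = 1 := by
  by_cases hN : N = 1
  · exact Or.inr hN
  refine Or.inl ?_
  have hn : nearest N y i < N ∧ nearest N y i ≠ i := by
    unfold nearest; split_ifs with h <;> omega
  have hD : y (nearest N y i) - y i ≠ 0 := by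
    rcases lt_or_gt_of_ne hn.2 with h | h
    · have := hy _ _ h hi
      linarith
    · have := hy _ _ h hn.1
      linarith
  exact (slopeOf_bounds hM (hz _) (hz _) hD (hc.slope_sq_le i hi) (hc.taylor i hi _ hn.1)).1

lemma Compatible.slope_sq {M : ℝ} {g : ℕ → ℝ} (hc : Compatible M N y z g) (hM : 0 ≤ M)
    (hz : ∀ i, 0 ≤ z i) {i : ℕ} (hi : i < N) :
    slope N y z i * slope N y z i ≤ 10 * (M * z i) := by
  by_cases hD : y (nearest N y i) - y i = 0
  · have : slope N y z i = 0 := by simp [slope, slopeOf, hD]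
    rw [this]
    have := mul_nonneg hM (hz i)
    linarith
  · have hn : nearest N y i < N := by
      unfold nearest; split_ifs with h <;> omega
    exact (slopeOf_bounds hM (hz _) (hz _) hD (hc.slope_sq_le i hi) (hc.taylor i hi _ hn)).2

lemma abs_nearest_sub_le_succ (hy : ∀ i j, i < j → j < N → y i < y j) {i : ℕ} (hi : i + 1 < N) :
    |y (nearest N y i) - y i| ≤ y (i + 1) - y i := by
  have h1 := hy i (i + 1) (by omega) hi
  unfold nearest
  split_ifs with h
  · rw [abs_of_pos (by linarith)]
  · simp only [hi, true_and] at h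
    push Not at h
    have := hy (i - 1) i (by omega) (by omega)
    rw [abs_of_neg (by linarith)]; linarith [h.2]

lemma abs_nearest_sub_le_pred (hy : ∀ i j, i < j → j < N → y i < y j) {i : ℕ} (h0 : 0 < i)
    (hi : i < N) : |y (nearest N y i) - y i| ≤ y i - y (i - 1) := by
  have h1 := hy (i - 1) i (by omega) hi
  unfold nearest
  split_ifs with h
  · have := hy i (i + 1) (by omega) h.1
    rw [abs_of_pos (by linarith)]
    rcases h.2 with h2 | h2
    · omega
    · exact h2.le
  · rw [abs_of_neg (by linarith)]; linarith

/-- The norm of the interpolant is controlled by any bound for compatible slopes. -/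
lemma Compatible.abs_splineJet_le {M : ℝ} {g : ℕ → ℝ} (hc : Compatible M N y z g) (hM : 0 ≤ M)
    (hy : ∀ i j, i < j → j < N → y i < y j) (hz : ∀ i, 0 ≤ z i) (t : ℝ) (m : Fin 3) :
    |splineJet N y z t m| ≤ 400 * M := by
  obtain ⟨k, hk, hle, hlt⟩ := exists_position hy t
  rw [splineJet_eq hy hk hle hlt]
  by_cases hpair : (0 < k ∧ k < N) ∧ y k - y (k - 1) ≤ 1
  · obtain ⟨⟨h0, hN⟩, hd⟩ := hpair
    have hlt1 := hy (k - 1) k (by omega) hN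
    have hg : gap N y k = y k - y (k - 1) := by rw [gap, if_pos ⟨h0, hN⟩, min_eq_left hd]
    have ht1 := hle (k - 1) (by omega)
    have ht2 := hlt k le_rfl hN
    rw [if_pos h0, if_pos hN, hg, Pi.add_apply, sideJet, sideJet]
    have e : t - y k = (t - y (k - 1)) - (y k - y (k - 1)) := by ring
    rw [e]
    have hk1 : k - 1 + 1 = k := by omega
    have hN1 : N ≠ 1 := by omega
    have b1 := (hc.slope_bounds hM hy hz (i := k - 1) (by omega)).resolve_right hN1
    have b2 := (hc.slope_bounds hM hy hz hN).resolve_right hN1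
    have n1 := abs_nearest_sub_le_succ hy (i := k - 1) (by omega)
    have n2 := abs_nearest_sub_le_pred hy h0 hN
    rw [hk1] at n1
    have hs := hc.slope_sub (k - 1) (by omega) k hN
    rw [abs_of_pos (by linarith : 0 < y k - y (k - 1))] at hs
    exact abs_pair_le (ga := g (k - 1)) (gb := g k) (by linarith) hd (by linarith) (by linarith)
      (hz _) (hz _) (hc.val_le _ (by omega)) (hc.slope_sq hM hz (by omega))
      (hc.slope_sq hM hz hN) (b1.trans (by gcongr)) (b2.trans (by gcongr)) hs
      (hc.taylor (k - 1) (by omega) k hN) m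
  · have hg : gap N y k = 1 := by
      unfold gap
      split_ifs with h
      · exact min_eq_right (by by_contra! h'; exact hpair ⟨h, h'.le⟩)
      · rfl
    rw [hg, Pi.add_apply]
    have hL : |(if 0 < k then sideJet N y z 1 1 (k - 1) t else 0) m| ≤ 200 * M := by
      split_ifs with h
      · exact abs_side_le (by simp) (hz _) (hc.val_le _ (by omega)) (hc.slope_sq hM hz (by omega))
          (by linarith [hle (k - 1) (by omega)]) m
      · simpa using hM
    have hR : |(if k < N then sideJet N y z (-1) 1 k t else 0) m| ≤ 200 * M := by
      split_ifs with h
      · exact abs_side_le (by simp) (hz _) (hc.val_le _ h) (hc.slope_sq hM hz h)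
          (by linarith [hlt k le_rfl h]) m
      · simpa using hM
    exact (abs_add_le _ _).trans (by linarith)

/-- Every list of nonnegative values is compatible with zero slopes for some bound. -/
lemma exists_compatible (hy : ∀ i j, i < j → j < N → y i < y j) (hz : ∀ i, 0 ≤ z i) :
    ∃ M, 0 ≤ M ∧ Compatible M N y z 0 := by
  set A := ∑ i ∈ Finset.range N, z i with hA
  set B := ∑ i ∈ Finset.range N, ∑ j ∈ Finset.range N, |z j - z i| / ((y j - y i) * (y j - y i))
    with hB
  have hA0 : 0 ≤ A := Finset.sum_nonneg fun i _ => hz i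
  have hterm : ∀ i j, 0 ≤ |z j - z i| / ((y j - y i) * (y j - y i)) := fun i j =>
    div_nonneg (abs_nonneg _) (mul_self_nonneg _)
  have hB0 : 0 ≤ B := Finset.sum_nonneg fun i _ => Finset.sum_nonneg fun j _ => hterm i j
  refine ⟨A + B, by positivity, ?_⟩
  constructor
  · intro i hi
    have := Finset.single_le_sum (fun j _ => hz j) (Finset.mem_range.2 hi)
    linarith
  · intro i _; simpa using mul_nonneg (by positivity : 0 ≤ A + B) (hz i)
  · intro i hi j hj
    simp only [Pi.zero_apply, zero_mul, sub_zero]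
    rcases eq_or_ne i j with rfl | hij
    · simp
    · have hne : y j - y i ≠ 0 := by
        rcases lt_or_gt_of_ne hij with h | h
        · have := hy _ _ h hj
          linarith
        · have := hy _ _ h hi
          linarith
      have hpos : 0 < (y j - y i) * (y j - y i) := mul_self_pos.2 hne
      rw [← div_le_iff₀ hpos]
      have h1 := Finset.single_le_sum (f := fun j => |z j - z i| / ((y j - y i) * (y j - y i)))
        (fun j _ => hterm i j) (Finset.mem_range.2 hj)
      have h2 := Finset.single_le_sum
        (f := fun i => ∑ j ∈ Finset.range N, |z j - z i| / ((y j - y i) * (y j - y i)))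
        (fun i _ => Finset.sum_nonneg fun j _ => hterm i j) (Finset.mem_range.2 hi)
      linarith
  · intro i _ j _; simpa using mul_nonneg (by positivity : 0 ≤ A + B) (abs_nonneg _)

end

/-- The values and slopes of a nonnegative function with `C²` norm at most `M` are compatible. -/
lemma compatible_of_function {G : ℝ → ℝ} {M : ℝ} (hG : ContDiff ℝ 2 G) (hG0 : ∀ t, 0 ≤ G t)
    (hM : ∀ (m : Fin 3) t, |iteratedDeriv m G t| ≤ M) (N : ℕ) {y z : ℕ → ℝ}
    (hz : ∀ i < N, z i = G (y i)) : Compatible M N y z fun i => deriv G (y i) := by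
  have hM0 : 0 ≤ M := (abs_nonneg _).trans (hM 0 0)
  have b0 : ∀ t, |G t| ≤ M := fun t => by simpa using hM 0 t
  have b1 : ∀ t, |deriv G t| ≤ M := fun t => by simpa [iteratedDeriv_one] using hM 1 t
  have b2 : ∀ t, |deriv (deriv G) t| ≤ M := fun t => by
    simpa [iteratedDeriv_succ, iteratedDeriv_zero] using hM 2 t
  have hd : Differentiable ℝ G := hG.differentiable (by norm_num)
  have hd' : Differentiable ℝ (deriv G) := by
    rw [show (2 : WithTop ℕ∞) = 1 + 1 by norm_num, contDiff_succ_iff_deriv] at hG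
    exact hG.2.2.differentiable (by norm_num)
  have lip : ∀ s t, |deriv G t - deriv G s| ≤ M * |t - s| := fun s t =>
    convex_univ.norm_image_sub_le_of_norm_deriv_le (fun x _ => hd' x) (fun x _ => b2 x)
      (Set.mem_univ s) (Set.mem_univ t)
  have taylor : ∀ s t, |G t - G s - deriv G s * (t - s)| ≤ M * ((t - s) * (t - s)) := by
    intro s t
    have h := (convex_uIcc s t).norm_image_sub_le_of_norm_hasDerivWithin_le
      (f := fun x => G x - deriv G s * x) (f' := fun x => deriv G x - deriv G s)
      (C := M * |t - s|) (fun x _ => by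
        have := (hd x).hasDerivAt.sub ((hasDerivAt_id x).const_mul (deriv G s))
        exact (this.congr_deriv (by ring)).hasDerivWithinAt)
      (fun x hx => (lip s x).trans (mul_le_mul_of_nonneg_left
        (by simpa using Set.abs_sub_left_of_mem_uIcc hx) hM0)) Set.left_mem_uIcc Set.right_mem_uIcc
    rw [Real.norm_eq_abs, Real.norm_eq_abs, mul_assoc, abs_mul_abs_self] at h
    convert h using 2
    ring
  refine ⟨fun i hi => ?_, fun i hi => ?_, fun i hi j hj => ?_, fun i _ j _ => lip _ _⟩
  · rw [hz i hi]; exact (le_abs_self _).trans (b0 _)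
  · rw [hz i hi]
    set x := y i
    rcases hM0.eq_or_lt with h0 | h0
    · have : deriv G x = 0 := by
        have := b1 x
        rw [← h0] at this
        exact abs_nonpos_iff.1 this
      simp [this, ← h0]
    · -- the Taylor bound at the point that nearly minimizes the quadratic majorant
      have h1 := (abs_le.1 (taylor x (x - deriv G x / (2 * M)))).2
      have h2 := hG0 (x - deriv G x / (2 * M))
      have e1 : x - deriv G x / (2 * M) - x = -(deriv G x / (2 * M)) := by ring
      rw [e1] at h1
      set c := deriv G x / (2 * M) with hc
      have hcM : deriv G x = c * (2 * M) := by rw [hc]; field_simp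
      rw [hcM] at h1 ⊢
      nlinarith
  · rw [hz i hi, hz j hj]; exact taylor _ _

end NonnegC2

/-! ### Reasoning about programs -/

namespace RealRAM

/-- The program `p`, started in `σ`, halts after at most `B` operations in a state with property
`Q`, within the storage bound `s`. -/
def Ends (s B : ℕ) (p : Cmd) (σ : State) (Q : State → Prop) : Prop :=
  ∃ (T : ℕ) (τ : State), T ≤ B ∧ Exec s p σ T τ ∧ Q τ

namespace Ends

variable {s B B' : ℕ} {p q : Cmd} {σ : State} {Q Q' : State → Prop}

lemma mono (h : Ends s B p σ Q) (hB : B ≤ B') (hQ : ∀ τ, Q τ → Q' τ) : Ends s B' p σ Q' := by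
  obtain ⟨T, τ, hT, hp, hτ⟩ := h
  exact ⟨T, τ, hT.trans hB, hp, hQ τ hτ⟩

lemma seq (hp : Ends s B p σ Q) (hq : ∀ τ, Q τ → Ends s B' q τ Q') :
    Ends s (B + B') (.seq p q) σ Q' := by
  obtain ⟨T, τ, hT, hp, hτ⟩ := hp
  obtain ⟨T', υ, hT', hq, hυ⟩ := hq τ hτ
  exact ⟨T + T', υ, add_le_add hT hT', .seq _ _ _ _ _ _ _ hp hq, hυ⟩

/-- Rule for loops: `I n` is an invariant that holds when at most `n` rounds remain. -/
lemma loop {b : Test} (I : ℕ → State → Prop)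
    (hstep : ∀ n σ, I n σ → b.Holds σ → ∃ n', n = n' + 1 ∧ Ends s B p σ (I n')) (n : ℕ)
    (σ : State) (hI : I n σ) :
    Ends s (n * (b.cost + B) + b.cost) (.loop b p) σ fun τ => ¬b.Holds τ ∧ ∃ m, I m τ := by
  induction n generalizing σ with
  | zero =>
    refine ⟨b.cost, σ, by omega, Exec.loop_stop _ _ _ ?_, ?_, 0, hI⟩ <;>
    · intro hb
      obtain ⟨n', h, -⟩ := hstep 0 σ hI hb
      omega
  | succ n ih =>
    by_cases hb : b.Holds σ
    · obtain ⟨n', h, T, τ, hT, hp, hτ⟩ := hstep _ σ hI hb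
      obtain rfl : n = n' := by omega
      obtain ⟨T', υ, hT', hl, hυ⟩ := ih τ hτ
      refine ⟨b.cost + T + T', υ, ?_, .loop_step _ _ _ _ _ _ _ hb hp hl, hυ⟩
      rw [Nat.succ_mul]
      omega
    · exact ⟨b.cost, σ, by omega, Exec.loop_stop _ _ _ hb, hb, n + 1, hI⟩

end Ends

/-- A choice, by nested tests, between expressions. -/
inductive Sel (α : Type) where
  | leaf (a : α)
  | ite (b : Test) (p q : Sel α)

namespace Sel

variable {α : Type}

noncomputable instance (b : Test) (σ : State) : Decidable (b.Holds σ) :=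
  match b with
  | .ilt a b => inferInstanceAs (Decidable (a.val σ < b.val σ))
  | .rlt a b => inferInstanceAs (Decidable (a.val σ < b.val σ))

/-- The expression chosen in the state `σ`. -/
noncomputable def pick (σ : State) : Sel α → α
  | leaf a => a
  | ite b p q => if b.Holds σ then p.pick σ else q.pick σ

/-- The program that performs the tests and then acts on the chosen expression. -/
def cmd (f : α → Cmd) : Sel α → Cmd
  | leaf a => f a
  | ite b p q => .ite b (p.cmd f) (q.cmd f)

/-- The largest cost over all branches. -/
def cost (c : α → ℕ) : Sel α → ℕ
  | leaf a => c a
  | ite b p q => b.cost + max (p.cost c) (q.cost c)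

lemma exec {s : ℕ} {f : α → Cmd} {c : α → ℕ} {σ τ : State} (S : Sel α)
    (h : ∀ a, a = S.pick σ → Exec s (f a) σ (c a) τ) :
    ∃ T ≤ S.cost c, Exec s (S.cmd f) σ T τ := by
  induction S with
  | leaf a => exact ⟨_, le_rfl, h a rfl⟩
  | ite b p q ihp ihq =>
    by_cases hb : b.Holds σ
    · obtain ⟨T, hT, hp⟩ := ihp (by simpa [pick, hb] using h)
      exact ⟨b.cost + T, by simp only [cost]; omega, .ite_pos _ _ _ _ _ _ hb hp⟩
    · obtain ⟨T, hT, hp⟩ := ihq (by simpa [pick, hb] using h)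
      exact ⟨b.cost + T, by simp only [cost]; omega, .ite_neg _ _ _ _ _ _ hb hp⟩

@[simp] lemma pick_leaf (σ : State) (a : α) : (leaf a).pick σ = a := rfl

@[simp] lemma pick_ilt (σ : State) (a b : IExp) (p q : Sel α) :
    (ite (.ilt a b) p q).pick σ = if a.val σ < b.val σ then p.pick σ else q.pick σ := rfl

@[simp] lemma pick_rlt (σ : State) (a b : RExp) (p q : Sel α) :
    (ite (.rlt a b) p q).pick σ = if a.val σ < b.val σ then p.pick σ else q.pick σ := rfl

end Sel

/-- Assignments whose right hand side is chosen by tests. -/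
inductive Instr where
  | setI (k : ℕ) (c : Sel IExp)
  | setR (k : ℕ) (c : Sel RExp)
  | store (addr : IExp) (c : Sel IExp)

namespace Instr

/-- The program of an assignment. -/
def cmd : Instr → Cmd
  | setI k c => c.cmd (.iset k)
  | setR k c => c.cmd (.rset k)
  | store addr c => c.cmd (.istore addr)

/-- The effect of an assignment. -/
noncomputable def run (σ : State) : Instr → State
  | setI k c => σ.setI k ((c.pick σ).val σ)
  | setR k c => σ.setR k ((c.pick σ).val σ)
  | store addr c => σ.storeI (addr.val σ) ((c.pick σ).val σ)

/-- The assignment respects the storage bound. -/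
def Ok (s : ℕ) (σ : State) : Instr → Prop
  | setI _ c => (c.pick σ).val σ ≤ s
  | setR _ _ => True
  | store addr c => addr.val σ < s ∧ (c.pick σ).val σ ≤ s

/-- An upper bound for the number of operations of an assignment. -/
def cost : Instr → ℕ
  | setI _ c => c.cost fun a => a.cost + 1
  | setR _ c => c.cost fun a => a.cost + 1
  | store addr c => c.cost fun a => addr.cost + a.cost + 1

lemma exec {s : ℕ} {σ : State} (i : Instr) (h : i.Ok s σ) :
    ∃ T ≤ i.cost, Exec s i.cmd σ T (i.run σ) := by
  cases i with
  | setI k c => exact c.exec fun a ha => by subst ha; exact .iset _ _ _ h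
  | setR k c => exact c.exec fun a ha => by subst ha; exact .rset _ _ _
  | store addr c => exact c.exec fun a ha => by subst ha; exact .istore _ _ _ h.1 h.2

end Instr

/-- The program of a list of assignments. -/
def prog : List Instr → Cmd
  | [] => .skip
  | i :: l => .seq i.cmd (prog l)

/-- The effect of a list of assignments. -/
noncomputable def run : List Instr → State → State
  | [], σ => σ
  | i :: l, σ => run l (i.run σ)

/-- A list of assignments respects the storage bound. -/
def Ok (s : ℕ) : List Instr → State → Prop
  | [], _ => True
  | i :: l, σ => i.Ok s σ ∧ Ok s l (i.run σ)

/-- An upper bound for the number of operations of a list of assignments. -/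
def cost : List Instr → ℕ
  | [] => 1
  | i :: l => i.cost + cost l

lemma run_append (l l' : List Instr) (σ : State) : run (l ++ l') σ = run l' (run l σ) := by
  induction l generalizing σ with
  | nil => rfl
  | cons i l ih => exact ih _

lemma ok_append {s : ℕ} (l l' : List Instr) (σ : State) :
    Ok s (l ++ l') σ ↔ Ok s l σ ∧ Ok s l' (run l σ) := by
  induction l generalizing σ with
  | nil => simp [Ok, run]
  | cons i l ih => simp only [List.cons_append, Ok, run, ih, and_assoc]

lemma exec_prog {s : ℕ} (l : List Instr) (σ : State) (h : Ok s l σ) :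
    ∃ T ≤ cost l, Exec s (prog l) σ T (run l σ) := by
  induction l generalizing σ with
  | nil => exact ⟨1, le_rfl, .skip _⟩
  | cons i l ih =>
    obtain ⟨T, hT, hi⟩ := i.exec h.1
    obtain ⟨T', hT', hl⟩ := ih _ h.2
    exact ⟨T + T', add_le_add hT hT', .seq _ _ _ _ _ _ _ hi hl⟩

lemma Ends.prog {s B : ℕ} {l : List Instr} {σ : State} {Q : State → Prop} (h : Ok s l σ)
    (hB : cost l ≤ B) (hQ : Q (run l σ)) : Ends s B (prog l) σ Q := by
  obtain ⟨T, hT, hl⟩ := exec_prog l σ h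
  exact ⟨T, _, hT.trans hB, hl, hQ⟩

attribute [simp] run Ok Instr.run Instr.Ok IExp.val RExp.val Test.Holds State.setI State.setR
  State.storeI State.storeR

end RealRAM

/-! ### Sorting by a tournament -/

namespace RealRAM

namespace Tournament

/-- The winner of two candidates: the one with the smaller key. Numbers that are not less than `N`
stand for the absence of a candidate. -/
noncomputable def better (N : ℕ) (X : ℕ → ℝ) (l r : ℕ) : ℕ :=
  if l < N then if r < N then if X r < X l then r else l else l else r

/-- `W 1, …, W (2 N - 1)` are the players of a tournament: the children of node `v` are `2 v` and
`2 v + 1`, and the leaves are `N, …, 2 N - 1`. The winner at node `v` is correct. -/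
def WonAt (N : ℕ) (X : ℕ → ℝ) (W : ℕ → ℕ) (v : ℕ) : Prop :=
  W v = better N X (W (2 * v)) (W (2 * v + 1))

variable {N : ℕ} {X : ℕ → ℝ} {W : ℕ → ℕ}

lemma better_le (l r : ℕ) :
    (l < N → better N X l r < N ∧ X (better N X l r) ≤ X l) ∧
      (r < N → better N X l r < N ∧ X (better N X l r) ≤ X r) := by
  unfold better
  split_ifs with h1 h2 h3
  · exact ⟨fun _ => ⟨h2, h3.le⟩, fun _ => ⟨h2, le_rfl⟩⟩
  · exact ⟨fun _ => ⟨h1, le_rfl⟩, fun _ => ⟨h1, not_lt.1 h3⟩⟩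
  · exact ⟨fun _ => ⟨h1, le_rfl⟩, fun h => absurd h h2⟩
  · exact ⟨fun h => absurd h h1, fun h => ⟨h, le_rfl⟩⟩

lemma better_eq (l r : ℕ) : better N X l r = l ∨ better N X l r = r := by
  unfold better
  split_ifs <;> simp

/-- The root beats every node. -/
lemma root_le (hW : ∀ v, 1 ≤ v → v < N → WonAt N X W v) (v : ℕ) (h1 : 1 ≤ v) (h2 : v < 2 * N)
    (hv : W v < N) : W 1 < N ∧ X (W 1) ≤ X (W v) := by
  induction v using Nat.strong_induction_on with
  | _ v ih =>
    rcases h1.eq_or_lt with rfl | h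
    · exact ⟨hv, le_rfl⟩
    have hu := hW (v / 2) (by omega) (by omega)
    have hb : W (v / 2) < N ∧ X (W (v / 2)) ≤ X (W v) := by
      rw [hu]
      rcases Nat.mod_two_eq_zero_or_one v with e | e
      · have : v = 2 * (v / 2) := by omega
        rw [← this]
        exact (better_le _ _).1 hv
      · have : v = 2 * (v / 2) + 1 := by omega
        rw [← this]
        exact (better_le _ _).2 hv
    obtain ⟨i1, i2⟩ := ih (v / 2) (by omega) (by omega) (by omega) hb.1
    exact ⟨i1, i2.trans hb.2⟩

/-- The winner at a node comes from a leaf. -/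
lemma exists_leaf (hW : ∀ v, 1 ≤ v → v < N → WonAt N X W v) (n v : ℕ) (hn : 2 * N ≤ v + n)
    (h1 : 1 ≤ v) (h2 : v < 2 * N) : ∃ a < N, W v = W (N + a) := by
  induction n generalizing v with
  | zero => omega
  | succ n ih =>
    by_cases h : N ≤ v
    · exact ⟨v - N, by omega, by rw [Nat.add_sub_cancel' h]⟩
    · rw [hW v h1 (by omega)]
      rcases better_eq (N := N) (X := X) (W (2 * v)) (W (2 * v + 1)) with e | e <;> rw [e]
      · exact ih _ (by omega) (by omega) (by omega)
      · exact ih _ (by omega) (by omega) (by omega)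

/-- The output after `o` rounds: `W (2 N), …, W (2 N + o - 1)` are indices in the order of their
keys, removed from their leaves (which then hold `N`), and all other leaves hold larger keys. -/
structure Partial (N : ℕ) (X : ℕ → ℝ) (W : ℕ → ℕ) (o : ℕ) : Prop where
  zero : W 0 = N
  le : ∀ a, W a ≤ N
  out_lt : ∀ j < o, W (2 * N + j) < N
  leaf : ∀ a < N, W (N + a) = a ∨ W (N + a) = N ∧ ∃ j < o, W (2 * N + j) = a
  out_removed : ∀ j < o, W (N + W (2 * N + j)) = N
  sorted : ∀ i j, i < j → j < o → X (W (2 * N + i)) < X (W (2 * N + j))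
  lt_leaf : ∀ j < o, ∀ a < N, W (N + a) = a → X (W (2 * N + j)) < X a

/-- While fewer than `N` indices have been put out, the root holds one of the remaining indices,
with the smallest key. -/
lemma Partial.root {o : ℕ} (h : Partial N X W o) (hW : ∀ v, 1 ≤ v → v < N → WonAt N X W v)
    (ho : o < N) :
    W 1 < N ∧ W (N + W 1) = W 1 ∧ ∀ a < N, W (N + a) = a → X (W 1) ≤ X a := by
  have hle : ∀ a < N, W (N + a) = a → W 1 < N ∧ X (W 1) ≤ X a := fun a ha hWa => by
    have := root_le hW (N + a) (by omega) (by omega) (by omega)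
    rwa [hWa] at this
  have hlt : W 1 < N := by
    by_contra hc
    -- otherwise the `o` indices put out so far exhaust all `N` indices
    have hsub : Finset.range N ⊆ (Finset.range o).image fun j => W (2 * N + j) := by
      intro a ha
      rw [Finset.mem_range] at ha
      rcases h.leaf a ha with e | ⟨-, j, hj, e⟩
      · exact absurd (hle a ha e).1 hc
      · exact Finset.mem_image.2 ⟨j, Finset.mem_range.2 hj, e⟩
    have := (Finset.card_le_card hsub).trans Finset.card_image_le
    simp only [Finset.card_range] at this
    omega
  obtain ⟨a, ha, e⟩ := exists_leaf hW (2 * N) 1 (by omega) le_rfl (by omega)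
  refine ⟨hlt, ?_, fun a ha hWa => (hle a ha hWa).2⟩
  rcases h.leaf a ha with e' | ⟨e', -⟩
  · have : W 1 = a := e.trans e'
    rw [this, e']
  · omega

/-- Putting out the index at the root and removing it from its leaf. -/
lemma Partial.extract {o : ℕ} {V : ℕ → ℕ} (h : Partial N X W o)
    (hX : ∀ a < N, ∀ b < N, X a = X b → a = b)
    (hW : ∀ v, 1 ≤ v → v < N → WonAt N X W v) (ho : o < N) (hV0 : V 0 = N) (hV : ∀ a, V a ≤ N)
    (hout : V (2 * N + o) = W 1) (hrem : V (N + W 1) = N)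
    (hVW : ∀ a, N ≤ a → a ≠ 2 * N + o → a ≠ N + W 1 → V a = W a) : Partial N X V (o + 1) := by
  obtain ⟨r1, r2, r3⟩ := h.root hW ho
  have hVout : ∀ j < o, V (2 * N + j) = W (2 * N + j) := fun j hj =>
    hVW _ (by omega) (by omega) (by omega)
  have hVleaf : ∀ a < N, a ≠ W 1 → V (N + a) = W (N + a) := fun a ha hne =>
    hVW _ (by omega) (by omega) (by omega)
  have hne : ∀ j < o, W (2 * N + j) ≠ W 1 := fun j hj e => by
    have := h.out_removed j hj
    rw [e, r2] at this
    omega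
  refine ⟨hV0, hV, fun j hj => ?_, fun a ha => ?_, fun j hj => ?_, fun i j hij hj => ?_,
    fun j hj a ha hVa => ?_⟩
  · rcases Nat.lt_succ_iff_lt_or_eq.1 hj with hj | rfl
    · rw [hVout j hj]; exact h.out_lt j hj
    · rwa [hout]
  · by_cases e : a = W 1
    · exact Or.inr ⟨by rw [e, hrem], o, by omega, by rw [hout, e]⟩
    · rw [hVleaf a ha e]
      rcases h.leaf a ha with h' | ⟨h', j, hj, hj'⟩
      · exact Or.inl h'
      · exact Or.inr ⟨h', j, by omega, by rw [hVout j hj, hj']⟩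
  · rcases Nat.lt_succ_iff_lt_or_eq.1 hj with hj | rfl
    · rw [hVout j hj, hVleaf _ (h.out_lt j hj) (hne j hj)]
      exact h.out_removed j hj
    · rw [hout, hrem]
  · rcases Nat.lt_succ_iff_lt_or_eq.1 hj with hj | rfl
    · rw [hVout i (by omega), hVout j hj]
      exact h.sorted i j hij hj
    · rw [hVout i hij, hout]
      exact h.lt_leaf i hij _ r1 r2
  · have hane : a ≠ W 1 := fun e => by
      rw [e, hrem] at hVa
      omega
    rw [hVleaf a ha hane] at hVa
    rcases Nat.lt_succ_iff_lt_or_eq.1 hj with hj | rfl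
    · rw [hVout j hj]
      exact h.lt_leaf j hj a ha hVa
    · rw [hout]
      exact lt_of_le_of_ne (r3 a ha hVa) fun e => hane (hX _ r1 _ ha e).symm

/-- Recomputing the winner at node `u` does not disturb the correctness elsewhere, except possibly
at the parent of `u`. -/
lemma wonAt_update {u v : ℕ} (hu : 1 ≤ u)
    (h : v = u ∨ v ≠ u / 2 ∧ WonAt N X W v) :
    WonAt N X (Function.update W u (better N X (W (2 * u)) (W (2 * u + 1)))) v := by
  unfold WonAt
  rcases eq_or_ne v u with rfl | hv
  · rw [Function.update_self, Function.update_of_ne (by omega), Function.update_of_ne (by omega)]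
  · have h' := h.resolve_left hv
    rw [Function.update_of_ne hv, Function.update_of_ne (by omega),
      Function.update_of_ne (by omega)]
    exact h'.2

/-- Recompute the winner at the node in register `1`. -/
def play : Instr :=
  .store (.reg 1) (.ite (.ilt (.mem (.add (.reg 1) (.reg 1))) (.reg 0))
    (.ite (.ilt (.mem (.add (.add (.reg 1) (.reg 1)) (.const 1))) (.reg 0))
      (.ite (.rlt (.mem (.mem (.add (.add (.reg 1) (.reg 1)) (.const 1))))
          (.mem (.mem (.add (.reg 1) (.reg 1)))))
        (.leaf (.mem (.add (.add (.reg 1) (.reg 1)) (.const 1))))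
        (.leaf (.mem (.add (.reg 1) (.reg 1)))))
      (.leaf (.mem (.add (.reg 1) (.reg 1)))))
    (.leaf (.mem (.add (.add (.reg 1) (.reg 1)) (.const 1)))))

lemma play_val {σ : State} (h0 : σ.ireg 0 = N) (hX : σ.rmem = X) :
    play.run σ = σ.storeI (σ.ireg 1)
      (better N X (σ.imem (2 * σ.ireg 1)) (σ.imem (2 * σ.ireg 1 + 1))) := by
  simp only [play, Instr.run, IExp.val, RExp.val, Sel.pick_ilt, Sel.pick_rlt, Sel.pick_leaf, h0, hX,
    ← two_mul, better]
  congr 1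
  split_ifs <;> simp only [IExp.val, two_mul]

lemma better_le_of_le {l r : ℕ} (hl : l ≤ N) (hr : r ≤ N) : better N X l r ≤ N := by
  rcases better_eq (N := N) (X := X) l r with e | e <;> rwa [e]

/-- Put every index on its leaf. -/
def fillLoop : Cmd :=
  .loop (.ilt (.reg 1) (.reg 0)) (prog [.store (.add (.reg 0) (.reg 1)) (.leaf (.reg 1)),
    .setI 1 (.leaf (.add (.reg 1) (.const 1)))])

/-- Play all matches, from the leaves to the root. -/
def buildLoop : Cmd :=
  .loop (.ilt (.const 1) (.reg 1)) (prog [.setI 1 (.leaf (.sub (.reg 1) (.const 1))), play])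

/-- Replay the matches on the way from the node in register `1` to the root. -/
def climbLoop : Cmd :=
  .loop (.ilt (.const 1) (.reg 1)) (prog [.setI 1 (.leaf (.half (.reg 1))), play])

/-- Put out the winner `N` times. -/
def extractLoop : Cmd :=
  .loop (.ilt (.reg 2) (.reg 0)) (.seq (prog
    [.store (.add (.add (.reg 0) (.reg 0)) (.reg 2)) (.leaf (.mem (.const 1))),
      .setI 1 (.leaf (.add (.reg 0) (.mem (.const 1)))), .store (.reg 1) (.leaf (.reg 0))])
    (.seq climbLoop (prog [.setI 2 (.leaf (.add (.reg 2) (.const 1)))])))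

/-- The sorting program. It stores the number of points in integer cell `0` and the sorted list of
indices in the integer cells from `2 N` on. -/
def sort : Cmd :=
  .seq (prog [.store (.const 0) (.leaf (.reg 0))])
    (.seq fillLoop (.seq buildLoop extractLoop))

lemma fillLoop_ends {s : ℕ} (hs : 3 * N + 3 ≤ s) {σ : State} (h0 : σ.ireg 0 = N)
    (h1 : σ.ireg 1 = 0) (h2 : σ.ireg 2 = 0) (hX : σ.rmem = X) (hm0 : σ.imem 0 = N)
    (hle : ∀ a, σ.imem a ≤ N) :
    Ends s (N * 20 + 3) fillLoop σ fun τ => (τ.ireg 0 = N ∧ τ.ireg 1 = N ∧ τ.ireg 2 = 0) ∧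
      τ.rmem = X ∧ τ.imem 0 = N ∧ (∀ a, τ.imem a ≤ N) ∧ ∀ a < N, τ.imem (N + a) = a := by
  refine (Ends.loop (B := 10) (fun n τ => (τ.ireg 0 = N ∧ τ.ireg 1 + n = N ∧ τ.ireg 2 = 0) ∧
    τ.rmem = X ∧ τ.imem 0 = N ∧ (∀ a, τ.imem a ≤ N) ∧ ∀ a < τ.ireg 1, τ.imem (N + a) = a)
    ?_ N σ ⟨⟨h0, by omega, h2⟩, hX, hm0, hle, by simp [h1]⟩).mono ?_ ?_
  · rintro n τ ⟨⟨r0, r1, r2⟩, rX, rm0, rle, rleaf⟩ hb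
    simp only [Test.Holds, IExp.val, r0] at hb
    refine ⟨n - 1, by omega, Ends.prog ?_ (by decide) ?_⟩
    · simp [r0]; omega
    · have hpos : 0 ≠ N + τ.ireg 1 := by omega
      simp only [run, Instr.run, IExp.val, Sel.pick_leaf, State.setI, State.storeI, r0,
        Function.update_self, Function.update_of_ne (show (0 : ℕ) ≠ 1 by decide),
        Function.update_of_ne (show (2 : ℕ) ≠ 1 by decide), Function.update_of_ne hpos]
      refine ⟨⟨trivial, by omega, r2⟩, rX, rm0, fun a => ?_, fun a ha => ?_⟩
      · rcases eq_or_ne a (N + τ.ireg 1) with rfl | h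
        · rw [Function.update_self]; omega
        · rw [Function.update_of_ne h]; exact rle a
      · rcases eq_or_ne a (τ.ireg 1) with rfl | h
        · rw [Function.update_self]
        · rw [Function.update_of_ne (by omega)]; exact rleaf a (by omega)
  · simp only [Test.cost, IExp.cost]; omega
  · rintro τ ⟨hb, n, ⟨r0, r1, r2⟩, rX, rm0, rle, rleaf⟩
    simp only [Test.Holds, IExp.val, r0] at hb
    have e : τ.ireg 1 = N := by omega
    rw [e] at rleaf
    exact ⟨⟨r0, e, r2⟩, rX, rm0, rle, rleaf⟩

lemma buildLoop_ends {s : ℕ} (hs : 3 * N + 3 ≤ s) {σ : State} (h0 : σ.ireg 0 = N)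
    (h1 : σ.ireg 1 = N) (h2 : σ.ireg 2 = 0) (hX : σ.rmem = X) (hm0 : σ.imem 0 = N)
    (hle : ∀ a, σ.imem a ≤ N) (hleaf : ∀ a < N, σ.imem (N + a) = a) :
    Ends s (N * 60 + 3) buildLoop σ fun τ => (τ.ireg 0 = N ∧ τ.ireg 2 = 0) ∧
      τ.rmem = X ∧ Partial N X τ.imem 0 ∧ ∀ v, 1 ≤ v → v < N → WonAt N X τ.imem v := by
  refine (Ends.loop (B := 50) (fun n τ => (τ.ireg 0 = N ∧ τ.ireg 1 - 1 = n ∧ τ.ireg 1 ≤ N ∧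
    τ.ireg 2 = 0) ∧ τ.rmem = X ∧ τ.imem 0 = N ∧ (∀ a, τ.imem a ≤ N) ∧
    (∀ a < N, τ.imem (N + a) = a) ∧ ∀ v, 1 ≤ v → τ.ireg 1 ≤ v → v < N → WonAt N X τ.imem v)
    ?_ (N - 1) σ ⟨⟨h0, by omega, h1.le, h2⟩, hX, hm0, hle, hleaf, by omega⟩).mono ?_ ?_
  · rintro n τ ⟨⟨r0, r1, r1', r2⟩, rX, rm0, rle, rleaf, rwon⟩ hb
    simp only [Test.Holds, IExp.val] at hb
    set u := τ.ireg 1 - 1 with hu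
    have hplay := play_val (N := N) (X := X) (σ := τ.setI 1 u) (by simpa using r0)
      (by simpa using rX)
    simp only [State.setI, Function.update_self] at hplay
    have hrun : run [.setI 1 (.leaf (.sub (.reg 1) (.const 1))), play] τ =
        (τ.setI 1 u).storeI u (better N X (τ.imem (2 * u)) (τ.imem (2 * u + 1))) := hplay
    have hbl : better N X (τ.imem (2 * u)) (τ.imem (2 * u + 1)) ≤ N :=
      better_le_of_le (rle _) (rle _)
    refine ⟨n - 1, by omega, Ends.prog ⟨?_, ⟨?_, ?_⟩, trivial⟩ (by decide) ?_⟩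
    · simp only [Instr.Ok, Sel.pick_leaf, IExp.val]; omega
    · simp only [Instr.run, Sel.pick_leaf, IExp.val, State.setI, Function.update_self]; omega
    · have := congrArg (fun ρ => ρ.imem u) hplay
      simp only [play, Instr.run, State.storeI, Sel.pick_leaf, IExp.val, State.setI,
        Function.update_self] at this ⊢
      exact this.le.trans (by omega)
    · rw [hrun]
      simp only [State.setI, State.storeI, Function.update_self,
        Function.update_of_ne (show (0 : ℕ) ≠ 1 by decide),
        Function.update_of_ne (show (2 : ℕ) ≠ 1 by decide)]
      refine ⟨⟨r0, by omega, by omega, r2⟩, rX, ?_, fun a => ?_, fun a ha => ?_,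
        fun v hv1 hv2 hv3 => wonAt_update (by omega) ?_⟩
      · rw [Function.update_of_ne (by omega)]; exact rm0
      · rcases eq_or_ne a u with rfl | h
        · rw [Function.update_self]; exact hbl
        · rw [Function.update_of_ne h]; exact rle a
      · rw [Function.update_of_ne (by omega)]; exact rleaf a ha
      · rcases eq_or_ne v u with h | h
        · exact Or.inl h
        · exact Or.inr ⟨by omega, rwon v hv1 (by omega) hv3⟩
  · simp only [Test.cost, IExp.cost]; omega
  · rintro τ ⟨hb, n, ⟨r0, r1, r1', r2⟩, rX, rm0, rle, rleaf, rwon⟩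
    simp only [Test.Holds, IExp.val] at hb
    refine ⟨⟨r0, r2⟩, rX, ⟨rm0, rle, by simp, fun a ha => Or.inl (rleaf a ha), by simp, by simp,
      by simp⟩, fun v h1 h2 => rwon v h1 (by omega) h2⟩

lemma climbLoop_ends {s o n : ℕ} (hs : 3 * N + 3 ≤ s) {σ : State} (h0 : σ.ireg 0 = N)
    (h1 : 1 ≤ σ.ireg 1) (h1' : σ.ireg 1 < 2 * N) (hn : σ.ireg 1 < 2 ^ (n + 1))
    (h2 : σ.ireg 2 = o) (hX : σ.rmem = X) (hle : ∀ a, σ.imem a ≤ N)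
    (hwon : ∀ v, 1 ≤ v → v < N → v ≠ σ.ireg 1 / 2 → WonAt N X σ.imem v) :
    Ends s (n * 60 + 3) climbLoop σ fun τ => (τ.ireg 0 = N ∧ τ.ireg 2 = o) ∧
      τ.rmem = X ∧ τ.imem 0 = σ.imem 0 ∧ (∀ a, τ.imem a ≤ N) ∧
      (∀ a, N ≤ a → τ.imem a = σ.imem a) ∧ ∀ v, 1 ≤ v → v < N → WonAt N X τ.imem v := by
  refine (Ends.loop (B := 50) (fun n τ => (τ.ireg 0 = N ∧ τ.ireg 2 = o ∧ 1 ≤ τ.ireg 1 ∧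
    τ.ireg 1 < 2 * N ∧ τ.ireg 1 < 2 ^ (n + 1)) ∧ τ.rmem = X ∧ τ.imem 0 = σ.imem 0 ∧
    (∀ a, τ.imem a ≤ N) ∧ (∀ a, N ≤ a → τ.imem a = σ.imem a) ∧
    ∀ v, 1 ≤ v → v < N → v ≠ τ.ireg 1 / 2 → WonAt N X τ.imem v)
    ?_ n σ ⟨⟨h0, h2, h1, h1', hn⟩, hX, rfl, hle, fun _ _ => rfl, hwon⟩).mono ?_ ?_
  · rintro n τ ⟨⟨r0, r2, r1, r1', rn⟩, rX, rm0, rle, rkeep, rwon⟩ hb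
    simp only [Test.Holds, IExp.val] at hb
    set u := τ.ireg 1 / 2 with hu
    have hplay := play_val (N := N) (X := X) (σ := τ.setI 1 u) (by simpa using r0)
      (by simpa using rX)
    simp only [State.setI, Function.update_self] at hplay
    have hrun : run [.setI 1 (.leaf (.half (.reg 1))), play] τ =
        (τ.setI 1 u).storeI u (better N X (τ.imem (2 * u)) (τ.imem (2 * u + 1))) := hplay
    have hbl : better N X (τ.imem (2 * u)) (τ.imem (2 * u + 1)) ≤ N :=
      better_le_of_le (rle _) (rle _)
    obtain ⟨n, rfl⟩ : ∃ n', n = n' + 1 := by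
      refine Nat.exists_eq_succ_of_ne_zero fun h => ?_
      rw [h] at rn
      omega
    rw [pow_succ] at rn
    refine ⟨n, rfl, Ends.prog ⟨?_, ⟨?_, ?_⟩, trivial⟩ (by decide) ?_⟩
    · simp only [Instr.Ok, Sel.pick_leaf, IExp.val]; omega
    · simp only [Instr.run, Sel.pick_leaf, IExp.val, State.setI, Function.update_self]; omega
    · have := congrArg (fun ρ => ρ.imem u) hplay
      simp only [play, Instr.run, State.storeI, Sel.pick_leaf, IExp.val, State.setI,
        Function.update_self] at this ⊢
      exact this.le.trans (by omega)
    · rw [hrun]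
      simp only [State.setI, State.storeI, Function.update_self,
        Function.update_of_ne (show (0 : ℕ) ≠ 1 by decide),
        Function.update_of_ne (show (2 : ℕ) ≠ 1 by decide)]
      refine ⟨⟨r0, r2, by omega, by omega, by omega⟩, rX, ?_, fun a => ?_, fun a ha => ?_,
        fun v hv1 hv2 hv3 => wonAt_update (by omega) ?_⟩
      · rw [Function.update_of_ne (by omega)]; exact rm0
      · rcases eq_or_ne a u with rfl | h
        · rw [Function.update_self]; exact hbl
        · rw [Function.update_of_ne h]; exact rle a
      · rw [Function.update_of_ne (by omega)]; exact rkeep a ha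
      · rcases eq_or_ne v u with h | h
        · exact Or.inl h
        · exact Or.inr ⟨by omega, rwon v hv1 hv2 h⟩
  · simp only [Test.cost, IExp.cost]; omega
  · rintro τ ⟨hb, n, ⟨r0, r2, r1, r1', rn⟩, rX, rm0, rle, rkeep, rwon⟩
    simp only [Test.Holds, IExp.val] at hb
    exact ⟨⟨r0, r2⟩, rX, rm0, rle, rkeep, fun v h1 h2 => rwon v h1 h2 (by omega)⟩

lemma extractLoop_ends {s n : ℕ} (hs : 3 * N + 3 ≤ s) (hn : 2 * N ≤ 2 ^ (n + 1))
    (hXinj : ∀ a < N, ∀ b < N, X a = X b → a = b) {σ : State}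
    (h0 : σ.ireg 0 = N) (h2 : σ.ireg 2 = 0) (hX : σ.rmem = X) (hP : Partial N X σ.imem 0)
    (hwon : ∀ v, 1 ≤ v → v < N → WonAt N X σ.imem v) :
    Ends s (N * (n * 60 + 40) + 3) extractLoop σ fun τ => τ.rmem = X ∧ Partial N X τ.imem N := by
  refine (Ends.loop (B := 22 + ((n * 60 + 3) + 8)) (fun m τ => (τ.ireg 0 = N ∧ τ.ireg 2 + m = N) ∧
    τ.rmem = X ∧ Partial N X τ.imem (τ.ireg 2) ∧ ∀ v, 1 ≤ v → v < N → WonAt N X τ.imem v)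
    ?_ N σ ⟨⟨h0, by omega⟩, hX, by rwa [h2], hwon⟩).mono ?_ ?_
  · rintro m τ ⟨⟨r0, r2⟩, rX, rP, rwon⟩ hb
    simp only [Test.Holds, IExp.val, r0] at hb
    obtain ⟨w1, w2, -⟩ := rP.root rwon hb
    refine ⟨m - 1, by omega, ?_⟩
    set o := τ.ireg 2 with ho
    set r := τ.imem 1 with hr
    set V := Function.update (Function.update τ.imem (N + N + o) r) (N + r) N with hV
    have hVle : ∀ a, V a ≤ N := fun a => by
      simp only [hV, Function.update_apply]
      split_ifs
      exacts [le_rfl, w1.le, rP.le a]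
    have hVkeep : ∀ a, a ≠ 2 * N + o → a ≠ N + r → V a = τ.imem a := fun a ha ha' => by
      rw [hV, Function.update_of_ne ha', Function.update_of_ne (by omega)]
    have hrun : run [.store (.add (.add (.reg 0) (.reg 0)) (.reg 2)) (.leaf (.mem (.const 1))),
        .setI 1 (.leaf (.add (.reg 0) (.mem (.const 1)))), .store (.reg 1) (.leaf (.reg 0))] τ =
        ⟨Function.update τ.ireg 1 (N + r), τ.rreg, V, τ.rmem⟩ := by
      have h1 : (1 : ℕ) ≠ N + N + o := by omega
      simp only [run, Instr.run, IExp.val, Sel.pick_leaf, State.setI, State.storeI, r0,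
        Function.update_self, Function.update_of_ne h1,
        Function.update_of_ne (show (0 : ℕ) ≠ 1 by decide), hV, ← hr, ← ho]
    refine Ends.seq (Q := fun ρ => ρ = ⟨Function.update τ.ireg 1 (N + r), τ.rreg, V, τ.rmem⟩)
      (Ends.prog ?_ (by decide) hrun) ?_
    · have h1 : (1 : ℕ) ≠ N + N + o := by omega
      simp only [Ok, Instr.Ok, Instr.run, IExp.val, Sel.pick_leaf, State.setI, State.storeI, r0,
        Function.update_self, Function.update_of_ne h1,
        Function.update_of_ne (show (0 : ℕ) ≠ 1 by decide), ← hr, ← ho]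
      exact ⟨⟨by omega, by omega⟩, by omega, ⟨by omega, by omega⟩, trivial⟩
    · rintro ρ rfl
      refine Ends.seq (climbLoop_ends (N := N) (X := X) (o := o) (n := n) hs ?_ ?_ ?_ ?_ ?_ rX hVle
        ?_) ?_
      · simpa using r0
      · simp only [Function.update_self]; omega
      · simp only [Function.update_self]; omega
      · simp only [Function.update_self]; omega
      · simp [ho]
      · simp only [Function.update_self]
        intro v hv1 hv2 hv3
        have := rwon v hv1 hv2
        unfold WonAt at this ⊢
        rw [hVkeep v (by omega) (by omega), hVkeep _ (by omega) (by omega),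
          hVkeep _ (by omega) (by omega), this]
      · rintro υ ⟨⟨u0, u2⟩, uX, um0, ule, ukeep, uwon⟩
        simp only at um0 ukeep
        refine Ends.prog ?_ (by decide) ?_
        · simp [u2]; omega
        · simp only [run, Instr.run, IExp.val, Sel.pick_leaf, State.setI, Function.update_self, u2,
            Function.update_of_ne (show (0 : ℕ) ≠ 2 by decide)]
          refine ⟨⟨u0, by omega⟩, uX, rP.extract hXinj rwon hb ?_ ule ?_ ?_ ?_, uwon⟩
          · rw [um0, hVkeep 0 (by omega) (by omega)]; exact rP.zero
          · rw [ukeep _ (by omega), hV, Function.update_of_ne (by omega), ← two_mul,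
              Function.update_self]
          · rw [ukeep _ (by omega), hV, Function.update_self]
          · intro a ha ha1 ha2
            rw [ukeep a ha, hVkeep a ha1 ha2]
  · simp only [Test.cost, IExp.cost]
    have : 1 + 1 + 1 + (22 + (n * 60 + 3 + 8)) ≤ n * 60 + 40 := by omega
    have := Nat.mul_le_mul_left N this
    omega
  · rintro τ ⟨hb, m, ⟨r0, r2⟩, rX, rP, rwon⟩
    simp only [Test.Holds, IExp.val, r0] at hb
    have : τ.ireg 2 = N := by omega
    rw [this] at rP
    exact ⟨rX, rP⟩

lemma sort_ends {s : ℕ} (hs : 3 * N + 3 ≤ s) (x : Fin N → ℝ) (hx : Function.Injective x) :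
    Ends s (N * (Nat.log 2 N * 60 + 200) + 20) sort (initState x) fun μ =>
      μ.rmem = (initState x).rmem ∧ Partial N (initState x).rmem μ.imem N := by
  have hXinj : ∀ a < N, ∀ b < N, (initState x).rmem a = (initState x).rmem b → a = b := by
    intro a ha b hb h
    simp only [initState, ha, hb, dif_pos] at h
    simpa using hx h
  have hn : 2 * N ≤ 2 ^ (Nat.log 2 N + 1 + 1) := by
    have := Nat.lt_pow_succ_log_self (b := 2) (by norm_num) N
    rw [pow_succ]
    simp only [Nat.succ_eq_add_one] at this
    omega
  refine (Ends.seq (Ends.prog (B := 5) (Q := fun τ => (τ.ireg 0 = N ∧ τ.ireg 1 = 0 ∧ τ.ireg 2 = 0) ∧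
    τ.rmem = (initState x).rmem ∧ τ.imem 0 = N ∧ ∀ a, τ.imem a ≤ N) ?_ (by decide) ?_) ?_).mono
    (B := 5 + ((N * 20 + 3) + ((N * 60 + 3) + (N * ((Nat.log 2 N + 1) * 60 + 40) + 3)))) ?_
    fun τ h => h
  · simp [initState]; omega
  · simp only [run, Instr.run, IExp.val, Sel.pick_leaf, State.storeI, initState, if_true,
      Function.update_self]
    refine ⟨⟨trivial, by simp, by simp⟩, trivial, trivial, fun a => ?_⟩
    rw [Function.update_apply]
    split_ifs <;> simp
  · rintro τ ⟨⟨r0, r1, r2⟩, rX, rm0, rle⟩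
    refine Ends.seq (fillLoop_ends hs r0 r1 r2 rX rm0 rle) ?_
    rintro τ ⟨⟨r0, r1, r2⟩, rX, rm0, rle, rleaf⟩
    refine Ends.seq (buildLoop_ends hs r0 r1 r2 rX rm0 rle rleaf) ?_
    rintro τ ⟨⟨r0, r2⟩, rX, rP, rwon⟩
    exact extractLoop_ends hs hn hXinj r0 r2 rX rP rwon
  · have : N * ((Nat.log 2 N + 1) * 60 + 40) = N * (Nat.log 2 N * 60) + N * 100 := by ring
    rw [this, Nat.mul_add]
    omega

end Tournament

end RealRAM

/-! ### Answering queries -/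

namespace RealRAM

namespace Query

open NonnegC2

/-- The real registers that an assignment writes. -/
def _root_.RealRAM.Instr.realTargets : Instr → List ℕ
  | .setR k _ => [k]
  | _ => []

/-- The integer registers that an assignment writes. -/
def _root_.RealRAM.Instr.intTargets : Instr → List ℕ
  | .setI k _ => [k]
  | _ => []

lemma run_rreg (l : List Instr) (σ : State) (k : ℕ) (hk : k ∉ l.flatMap Instr.realTargets) :
    (run l σ).rreg k = σ.rreg k := by
  induction l generalizing σ with
  | nil => rfl
  | cons i l ih =>
    simp only [List.flatMap_cons, List.mem_append, not_or] at hk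
    rw [run, ih _ hk.2]
    cases i with
    | setR j c => exact Function.update_of_ne (by simpa [Instr.realTargets] using hk.1) _ _
    | setI j c => rfl
    | store a c => rfl

lemma run_ireg (l : List Instr) (σ : State) (k : ℕ) (hk : k ∉ l.flatMap Instr.intTargets) :
    (run l σ).ireg k = σ.ireg k := by
  induction l generalizing σ with
  | nil => rfl
  | cons i l ih =>
    simp only [List.flatMap_cons, List.mem_append, not_or] at hk
    rw [run, ih _ hk.2]
    cases i with
    | setI j c => exact Function.update_of_ne (by simpa [Instr.intTargets] using hk.1) _ _
    | setR j c => rfl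
    | store a c => rfl

/-- The assignment changes registers only. -/
def _root_.RealRAM.Instr.isRegister : Instr → Bool
  | .store _ _ => false
  | _ => true

lemma run_mem (l : List Instr) (σ : State) (hl : l.all Instr.isRegister = true) :
    (run l σ).imem = σ.imem ∧ (run l σ).rmem = σ.rmem := by
  induction l generalizing σ with
  | nil => exact ⟨rfl, rfl⟩
  | cons i l ih =>
    simp only [List.all_cons, Bool.and_eq_true] at hl
    rw [run, (ih _ hl.2).1, (ih _ hl.2).2]
    cases i with
    | setR j c => exact ⟨rfl, rfl⟩
    | setI j c => exact ⟨rfl, rfl⟩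
    | store a c => exact absurd hl.1 (by simp [Instr.isRegister])

/-- Address of the index of the point in sorted position `i`, when integer register `12` holds
`2 N`. -/
abbrev posExp (i : IExp) : IExp := .mem (.add (.reg 12) i)

/-- The point in sorted position `i`. -/
abbrev nodeExp (i : IExp) : RExp := .mem (posExp i)

/-- Binary search for the number of points that are at most the real number in register `0`; the
result is left in integer register `11`. -/
def searchLoop : Cmd :=
  .loop (.ilt (.reg 11) (.reg 13)) (prog
    [.setI 15 (.leaf (.half (.add (.reg 11) (.reg 13)))),
      .setI 16 (.ite (.rlt (.reg 0) (nodeExp (.reg 15))) (.leaf (.reg 11))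
        (.leaf (.add (.reg 15) (.const 1)))),
      .setI 13 (.ite (.rlt (.reg 0) (nodeExp (.reg 15))) (.leaf (.reg 15)) (.leaf (.reg 13))),
      .setI 11 (.leaf (.reg 16))])

/-- Registers `10`, `12` and `13` receive `N`, `2 N` and `N`. -/
def setup : List Instr :=
  [.setI 10 (.leaf (.mem (.const 0))), .setI 12 (.leaf (.add (.reg 10) (.reg 10))),
    .setI 13 (.leaf (.reg 10))]

/-- The first position of the window goes to integer register `14`, the cutoff length at the query
point to real register `1`. -/
def prepare : List Instr :=
  [.setI 14 (.leaf (.sub (.reg 11) (.const 2))),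
    .setR 1 (.ite (.ilt (.const 0) (.reg 11)) (.ite (.ilt (.reg 11) (.reg 10))
      (.ite (.rlt (.const 1) (.sub (nodeExp (.reg 11)) (nodeExp (.sub (.reg 11) (.const 1)))))
        (.leaf (.const 1))
        (.leaf (.sub (nodeExp (.reg 11)) (nodeExp (.sub (.reg 11) (.const 1))))))
      (.leaf (.const 1))) (.leaf (.const 1)))]

/-- The indicator of equality of the integer register `i` with the window position `r`. -/
def selector (k i r : ℕ) : Instr :=
  .setR k (.ite (.ilt (.add (.reg 14) (.const r)) (.reg i)) (.leaf (.const 0))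
    (.ite (.ilt (.reg i) (.add (.reg 14) (.const r))) (.leaf (.const 0)) (.leaf (.const 1))))

/-- The constants that describe the contribution of the node in position `i`, which is on the side
given by `σ = ± 1` of the query point: real registers from `b` on receive the signed distance, the
reciprocal distance to the nearest node, the jet of the cutoff (zero if the test `act` fails), and
the position of the node and of its nearest node in the window. -/
def describe (b : ℕ) (σ : ℚ) (i : IExp) (act : Test) : List Instr :=
  [.setI 15 (.leaf i),
    .setI 16 (.ite (.ilt (.add (.reg 15) (.const 1)) (.reg 10))
      (.ite (.ilt (.reg 15) (.const 1)) (.leaf (.add (.reg 15) (.const 1)))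
        (.ite (.rlt (.sub (nodeExp (.add (.reg 15) (.const 1))) (nodeExp (.reg 15)))
            (.sub (nodeExp (.reg 15)) (nodeExp (.sub (.reg 15) (.const 1)))))
          (.leaf (.add (.reg 15) (.const 1))) (.leaf (.sub (.reg 15) (.const 1)))))
      (.leaf (.sub (.reg 15) (.const 1)))),
    .setR b (.leaf (.sub (.reg 0) (nodeExp (.reg 15)))),
    .setR (b + 1) (.leaf (.div (.const 1) (.sub (nodeExp (.reg 16)) (nodeExp (.reg 15))))),
    .setR 2 (.ite (.rlt (.div (.mul (.const σ) (.reg b)) (.reg 1)) (.const 1))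
      (.leaf (.div (.mul (.const σ) (.reg b)) (.reg 1))) (.leaf (.const 1))),
    .setR (b + 2) (.ite act (.leaf (.sub (.const 1) (.mul (.mul (.mul (.reg 2) (.reg 2)) (.reg 2))
      (.add (.sub (.const 10) (.mul (.const 15) (.reg 2)))
        (.mul (.const 6) (.mul (.reg 2) (.reg 2))))))) (.leaf (.const 0))),
    .setR (b + 3) (.ite act (.leaf (.sub (.const 0) (.div (.mul (.const σ)
      (.mul (.mul (.const 30) (.mul (.reg 2) (.reg 2)))
        (.mul (.sub (.const 1) (.reg 2)) (.sub (.const 1) (.reg 2))))) (.reg 1))))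
      (.leaf (.const 0))),
    .setR (b + 4) (.ite act (.leaf (.sub (.const 0) (.div
      (.mul (.mul (.mul (.const 60) (.reg 2)) (.sub (.const 1) (.reg 2)))
        (.sub (.const 1) (.mul (.const 2) (.reg 2)))) (.mul (.reg 1) (.reg 1)))))
      (.leaf (.const 0))),
    selector (b + 5) 15 0, selector (b + 6) 15 1, selector (b + 7) 15 2, selector (b + 8) 15 3,
    selector (b + 9) 16 0, selector (b + 10) 16 1, selector (b + 11) 16 2, selector (b + 12) 16 3]

/-- The number of points in the window and their indices go to the integer registers `0, …, 4`. -/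
def output : List Instr :=
  [.setI 0 (.ite (.ilt (.add (.reg 11) (.const 2)) (.reg 10))
      (.leaf (.sub (.add (.reg 11) (.const 2)) (.reg 14))) (.leaf (.sub (.reg 10) (.reg 14)))),
    .setI 1 (.leaf (posExp (.reg 14))),
    .setI 2 (.leaf (posExp (.add (.reg 14) (.const 1)))),
    .setI 3 (.leaf (posExp (.add (.reg 14) (.const 2)))),
    .setI 4 (.leaf (posExp (.add (.reg 14) (.const 3))))]

/-- The description of the node to the left of the query point. -/
def describeLeft : List Instr :=
  describe 10 1 (.sub (.reg 11) (.const 1)) (.ilt (.const 0) (.reg 11))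

/-- The description of the node to the right of the query point. -/
def describeRight : List Instr :=
  describe 30 (-1) (.reg 11) (.ilt (.reg 11) (.reg 10))

/-- The query program. -/
def query : Cmd :=
  .seq (prog setup) (.seq searchLoop
    (prog (prepare ++ (describeLeft ++ (describeRight ++ output)))))

/-- The state of the machine when the position `k` of the query point has been found: sorted
position `i` holds the point `y i`. -/
structure Located (N k : ℕ) (t : ℝ) (y : ℕ → ℝ) (W : ℕ → ℕ) (X : ℕ → ℝ) (σ : State) : Prop where
  card : σ.ireg 10 = N
  pos : σ.ireg 11 = k
  base : σ.ireg 12 = 2 * N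
  point : σ.rreg 0 = t
  imem : σ.imem = W
  rmem : σ.rmem = X
  node : ∀ i, X (W (2 * N + i)) = y i

/-- The constants describing the contribution of the node in position `i`, in registers from `b`
on. -/
structure NodeData (N : ℕ) (y : ℕ → ℝ) (lo i : ℕ) (t σ g : ℝ) (act : Prop) [Decidable act] (b : ℕ)
    (ρ : ℕ → ℝ) : Prop where
  dist : ρ b = t - y i
  recip : ρ (b + 1) = 1 / (y (nearest N y i) - y i)
  cut : ∀ m : Fin 3, ρ (b + 2 + m) = if act then cutJet σ g (t - y i) m else 0
  self : ∀ r < 4, ρ (b + 5 + r) = if lo + r = i then 1 else 0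
  other : ∀ r < 4, ρ (b + 9 + r) = if lo + r = nearest N y i then 1 else 0

lemma selector_val (i r : ℕ) (σ : State) (k : ℕ) :
    ((selector k i r).run σ) = σ.setR k (if σ.ireg 14 + r = σ.ireg i then 1 else 0) := by
  simp only [selector, Instr.run, Sel.pick_ilt, IExp.val, Sel.pick_leaf]
  congr 1
  rcases lt_trichotomy (σ.ireg 14 + r) (σ.ireg i) with h | h | h
  · simp [h, h.ne]
  · simp [h]
  · simp [h, h.not_gt, h.ne']

variable {N k : ℕ} {t : ℝ} {y : ℕ → ℝ} {W : ℕ → ℕ} {X : ℕ → ℝ} {σ : State}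

lemma describe_spec {b lo i : ℕ} {sg : ℚ} {g : ℝ} {iE : IExp} {act : Test}
    (hσ : Located N k t y W X σ) (h14 : σ.ireg 14 = lo) (h1 : σ.rreg 1 = g) (hg : 0 ≤ g)
    (hb : b = 10 ∨ b = 30)
    (hi : iE.val σ = i) {a a' : IExp} (hact : act = .ilt a a') {P : Prop} [Decidable P]
    (ha : ∀ τ : State, τ.ireg 10 = N → τ.ireg 11 = k → (a.val τ < a'.val τ ↔ P))
    (hP : P → 0 ≤ (sg : ℝ) * (t - y i)) :
    NodeData N y lo i t sg g P b (run (describe b sg iE act) σ).rreg := by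
  obtain ⟨s10, s11, s12, s0, sW, sX, sy⟩ := hσ
  set σ1 : State := σ.setI 15 i with hσ1
  have hn : (Instr.run σ1 (.setI 16 (.ite (.ilt (.add (.reg 15) (.const 1)) (.reg 10))
      (.ite (.ilt (.reg 15) (.const 1)) (.leaf (.add (.reg 15) (.const 1)))
        (.ite (.rlt (.sub (nodeExp (.add (.reg 15) (.const 1))) (nodeExp (.reg 15)))
            (.sub (nodeExp (.reg 15)) (nodeExp (.sub (.reg 15) (.const 1)))))
          (.leaf (.add (.reg 15) (.const 1))) (.leaf (.sub (.reg 15) (.const 1)))))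
      (.leaf (.sub (.reg 15) (.const 1)))))) = σ1.setI 16 (nearest N y i) := by
    have e10 : σ1.ireg 10 = N := by simpa [hσ1] using s10
    have e12 : σ1.ireg 12 = 2 * N := by simpa [hσ1] using s12
    have e15 : σ1.ireg 15 = i := by simp [hσ1]
    have eW : σ1.imem = W := sW
    have eX : σ1.rmem = X := sX
    simp only [Instr.run, Sel.pick_ilt, Sel.pick_rlt, Sel.pick_leaf, IExp.val, RExp.val, e10, e12,
      e15, eW, eX, sy, nearest]
    congr 1
    by_cases c1 : i + 1 < N
    · by_cases c2 : i = 0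
      · have c1' : 1 < N := by omega
        simp [c1', c2, e15]
      · by_cases c3 : y (i + 1) - y i < y i - y (i - 1)
        · simp [c1, c2, c3, e15]
        · simp [c1, c2, c3, e15]
    · simp [c1, e15]
  have hrun1 : ∀ l, run (.setI 15 (.leaf iE) :: l) σ = run l σ1 := fun l => by
    simp only [run, Instr.run, Sel.pick_leaf, hi, hσ1]
  rw [describe, hrun1, run, hn]
  set σ2 := σ1.setI 16 (nearest N y i) with hσ2
  have e10 : σ2.ireg 10 = N := by simpa [hσ2, hσ1] using s10
  have e11 : σ2.ireg 11 = k := by simpa [hσ2, hσ1] using s11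
  have e12 : σ2.ireg 12 = 2 * N := by simpa [hσ2, hσ1] using s12
  have e14 : σ2.ireg 14 = lo := by simpa [hσ2, hσ1] using h14
  have e15 : σ2.ireg 15 = i := by simp [hσ2, hσ1]
  have e16 : σ2.ireg 16 = nearest N y i := by simp [hσ2]
  have eW : σ2.imem = W := sW
  have eX : σ2.rmem = X := sX
  have e0 : σ2.rreg 0 = t := s0
  have e1 : σ2.rreg 1 = g := h1
  clear_value σ2
  -- the clamped argument of the smooth step
  set v : ℝ := if (sg : ℝ) * (t - y i) / g < 1 then (sg : ℝ) * (t - y i) / g else 1 with hv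
  have hclamp : P → clamp ((sg : ℝ) * (t - y i) / g) = v := fun h => by
    have h0 : 0 ≤ (sg : ℝ) * (t - y i) / g := div_nonneg (hP h) hg
    rw [hv]
    split_ifs with h'
    · exact clamp_of_mem h0 h'.le
    · exact clamp_of_one_le (not_lt.1 h')
  have hact' : ∀ (τ : State) (p q : Sel RExp), τ.ireg 10 = N → τ.ireg 11 = k →
      (Sel.ite act p q).pick τ = if P then p.pick τ else q.pick τ := fun τ p q h10 h11 => by
    rw [hact, Sel.pick_ilt]
    exact if_congr (ha τ h10 h11) rfl rfl
  obtain ⟨I, R, W', X'⟩ := σ2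
  simp only at e10 e11 e12 e14 e15 e16 eW eX e0 e1
  subst eW eX
  have hne : b ≠ 2 := by omega
  set ρ : ℕ → ℝ := Function.update (Function.update (Function.update R b (t - y i)) (b + 1)
    (1 / (y (nearest N y i) - y i))) 2 v with hρ
  have hρ0 : ρ 1 = g ∧ ρ 2 = v := by
    constructor
    · rw [hρ, Function.update_of_ne (by omega), Function.update_of_ne (by omega),
        Function.update_of_ne (by omega), e1]
    · rw [hρ, Function.update_self]
  have hstage : ∀ l, run (.setR b (.leaf (.sub (.reg 0) (nodeExp (.reg 15)))) ::
      .setR (b + 1) (.leaf (.div (.const 1) (.sub (nodeExp (.reg 16)) (nodeExp (.reg 15))))) ::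
      .setR 2 (.ite (.rlt (.div (.mul (.const sg) (.reg b)) (.reg 1)) (.const 1))
        (.leaf (.div (.mul (.const sg) (.reg b)) (.reg 1))) (.leaf (.const 1))) :: l)
      ⟨I, R, W', X'⟩ =
      run l ⟨I, ρ, W', X'⟩ := fun l => by
    rw [run, run, run]
    congr 1
    have n1 : (1 : ℕ) ≠ b := by omega
    have n2 : (1 : ℕ) ≠ b + 1 := by omega
    have n3 : b ≠ b + 1 := by omega
    simp only [Instr.run, Sel.pick_leaf, Sel.pick_rlt, State.setR, RExp.val, IExp.val, e12, e15,
      e16, sy, e0, e1, Function.update_self, Function.update_of_ne n1, Function.update_of_ne n2,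
      Function.update_of_ne n3, Rat.cast_one, hρ, hv]
    congr 2
    split_ifs <;> simp [RExp.val, Function.update_of_ne n1, Function.update_of_ne n2, e1]
  rw [hstage]
  have hact2 : ∀ (S : ℕ → ℝ) (p q : Sel RExp), (Sel.ite act p q).pick ⟨I, S, W', X'⟩ =
      if P then p.pick ⟨I, S, W', X'⟩ else q.pick ⟨I, S, W', X'⟩ := fun S p q => hact' _ p q e10 e11
  have n1 : (1 : ℕ) ≠ b + 2 := by omega
  have n2 : (2 : ℕ) ≠ b + 2 := by omega
  have n3 : (1 : ℕ) ≠ b + 3 := by omega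
  have n4 : (2 : ℕ) ≠ b + 3 := by omega
  simp only [run, selector_val]
  simp only [Instr.run, Sel.pick_leaf, State.setR, RExp.val, e14, e15, e16,
    hact2, apply_ite (RExp.val _), hρ0, Function.update_of_ne n1,
    Function.update_of_ne n2, Function.update_of_ne n3, Function.update_of_ne n4]
  have hcut : ∀ m : Fin 3, P → cutJet sg g (t - y i) m =
      ![1 - v * v * v * (10 - 15 * v + 6 * (v * v)),
        0 - sg * (30 * (v * v) * ((1 - v) * (1 - v))) / g,
        0 - 60 * v * (1 - v) * (1 - 2 * v) / (g * g)] m := fun m hm => by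
    simp only [cutJet, step, hclamp hm, quintic, Matrix.cons_val]
    fin_cases m <;> simp
  clear_value v
  have hb0 : ρ b = t - y i := by
    rw [hρ, Function.update_of_ne hne, Function.update_of_ne (by omega), Function.update_self]
  have hb1 : ρ (b + 1) = 1 / (y (nearest N y i) - y i) := by
    rw [hρ, Function.update_of_ne (by omega), Function.update_self]
  clear_value ρ
  refine ⟨?_, ?_, fun m => ?_, fun r hr => ?_, fun r hr => ?_⟩
  · rcases hb with rfl | rfl <;> simpa [Function.update_apply] using hb0
  · rcases hb with rfl | rfl <;> simpa [Function.update_apply] using hb1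
  · by_cases hp : P
    · rw [if_pos hp, hcut m hp]
      rcases hb with rfl | rfl <;> fin_cases m <;> simp [hp]
    · rw [if_neg hp]
      rcases hb with rfl | rfl <;> fin_cases m <;> simp [hp]
  · rcases hb with rfl | rfl <;> interval_cases r <;> simp
  · rcases hb with rfl | rfl <;> interval_cases r <;> simp

lemma describe_ok {s b i : ℕ} {sg : ℚ} {iE : IExp} {act : Test} (hs : 3 * N + 3 ≤ s) (hi : i ≤ N)
    (hiE : iE.val σ = i) (h10 : σ.ireg 10 = N) : Ok s (describe b sg iE act) σ := by
  simp only [describe, Ok, Instr.Ok, Instr.run, Sel.pick_leaf, selector, State.setI, hiE, and_true,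
    Sel.pick_ilt, Sel.pick_rlt, apply_ite (IExp.val _), IExp.val, Function.update_self]
  refine ⟨by omega, ?_⟩
  split_ifs <;> omega

lemma Located.of_run {l : List Instr} (h : Located N k t y W X σ)
    (hi : ∀ r ∈ [10, 11, 12], r ∉ l.flatMap Instr.intTargets)
    (hr : 0 ∉ l.flatMap Instr.realTargets) (hl : l.all Instr.isRegister = true) :
    Located N k t y W X (run l σ) where
  card := by rw [run_ireg _ _ _ (hi 10 (by simp))]; exact h.card
  pos := by rw [run_ireg _ _ _ (hi 11 (by simp))]; exact h.pos
  base := by rw [run_ireg _ _ _ (hi 12 (by simp))]; exact h.base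
  point := by rw [run_rreg _ _ _ hr]; exact h.point
  imem := (run_mem l σ hl).1.trans h.imem
  rmem := (run_mem l σ hl).2.trans h.rmem
  node := h.node

/-- What the query program returns when the query point has position `k`: the size of the window,
the indices of its points and the description of the two nodes next to the query point. -/
structure Answer (N k : ℕ) (t : ℝ) (y : ℕ → ℝ) (W : ℕ → ℕ) (X : ℕ → ℝ) (τ : State) : Prop where
  imem : τ.imem = W
  rmem : τ.rmem = X
  size : τ.ireg 0 = min (k + 2) N - (k - 2)
  index : ∀ j < 4, τ.ireg (j + 1) = W (2 * N + (k - 2 + j))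
  left : NodeData N y (k - 2) (k - 1) t 1 (gap N y k) (0 < k) 10 τ.rreg
  right : NodeData N y (k - 2) k t (-1) (gap N y k) (k < N) 30 τ.rreg

lemma NodeData.congr {lo i b : ℕ} {sg g : ℝ} {act : Prop} [Decidable act] {ρ ρ' : ℕ → ℝ}
    (h : NodeData N y lo i t sg g act b ρ) (hρ : ∀ r < 13, ρ' (b + r) = ρ (b + r)) :
    NodeData N y lo i t sg g act b ρ' where
  dist := (hρ 0 (by norm_num)).trans h.dist
  recip := (hρ 1 (by norm_num)).trans h.recip
  cut m := by rw [add_assoc, hρ (2 + m) (by omega), ← add_assoc]; exact h.cut m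
  self r hr := by rw [add_assoc, hρ (5 + r) (by omega), ← add_assoc]; exact h.self r hr
  other r hr := by rw [add_assoc, hρ (9 + r) (by omega), ← add_assoc]; exact h.other r hr

lemma prepare_spec (h : Located N k t y W X σ) :
    (run prepare σ).ireg 14 = k - 2 ∧ (run prepare σ).rreg 1 = gap N y k := by
  obtain ⟨s10, s11, s12, s0, sW, sX, sy⟩ := h
  have n1 : (11 : ℕ) ≠ 14 := by decide
  have n2 : (10 : ℕ) ≠ 14 := by decide
  have n3 : (12 : ℕ) ≠ 14 := by decide
  constructor
  · simp [prepare, s11]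
  · simp only [prepare, run, Instr.run, Sel.pick_leaf, Sel.pick_ilt, Sel.pick_rlt, State.setI,
      State.setR, IExp.val, RExp.val, Function.update_self, Function.update_of_ne n1,
      Function.update_of_ne n2, Function.update_of_ne n3, s10, s11, s12, sW, sX, sy, gap,
      apply_ite (RExp.val _), Rat.cast_one]
    by_cases c1 : 0 < k
    · by_cases c2 : k < N
      · by_cases c3 : 1 < y k - y (k - 1)
        · simp [c1, c2, c3, c3.le]
        · simp [c1, c2, c3, not_lt.1 c3]
      · rw [if_pos c1, if_neg c2, if_neg (fun h => c2 h.2)]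
    · rw [if_neg c1, if_neg (fun h => c1 h.1)]

lemma output_spec (h : Located N k t y W X σ) (h14 : σ.ireg 14 = k - 2) :
    (run output σ).ireg 0 = min (k + 2) N - (k - 2) ∧
      ∀ j < 4, (run output σ).ireg (j + 1) = W (2 * N + (k - 2 + j)) := by
  obtain ⟨s10, s11, s12, s0, sW, sX, sy⟩ := h
  constructor
  · rw [output, run, run_ireg _ _ _ (by decide)]
    simp only [Instr.run, Sel.pick_ilt, IExp.val, s10, s11, State.setI, Function.update_self]
    split_ifs with c
    · simp only [Sel.pick_leaf, IExp.val, s11, h14, min_eq_left c.le]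
    · simp only [Sel.pick_leaf, IExp.val, s10, h14, min_eq_right (not_lt.1 c)]
  · intro j hj
    interval_cases j <;> simp [output, s12, h14, sW]

lemma output_ok {s : ℕ} (h : Located N k t y W X σ) (hs : 3 * N + 3 ≤ s) (hW : ∀ a, W a ≤ N) :
    Ok s output σ := by
  have hW' : ∀ a, W a ≤ s := fun a => (hW a).trans (by omega)
  obtain ⟨s10, s11, s12, s0, sW, sX, sy⟩ := h
  simp only [output, Ok, Instr.Ok, Instr.run, Sel.pick_leaf, State.setI, and_true, IExp.val, sW,
    hW', Sel.pick_ilt, s10, s11]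
  split_ifs with c <;> simp only [IExp.val, s10, s11] <;> omega

lemma respond_ends {s : ℕ} (hs : 3 * N + 3 ≤ s) (hk : k ≤ N) (h : Located N k t y W X σ)
    (hW : ∀ a, W a ≤ N) (hy : ∀ i j, i < j → j < N → y i < y j) (hle : ∀ i < k, y i ≤ t)
    (hlt : ∀ i, k ≤ i → i < N → t < y i) :
    Ends s 1000 (prog (prepare ++ (describeLeft ++ (describeRight ++ output)))) σ
      (Answer N k t y W X) := by
  obtain ⟨p14, p1⟩ := prepare_spec h
  have hg := (gap_pos hy k).le
  have hok1 : Ok s prepare σ := by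
    simp only [prepare, Ok, Instr.Ok, Sel.pick_leaf, IExp.val, h.pos, and_true]; omega
  have h1 : Located N k t y W X (run prepare σ) := h.of_run (by decide) (by decide) (by decide)
  set σ1 := run prepare σ with hσ1
  have hL : NodeData N y (k - 2) (k - 1) t ((1 : ℚ) : ℝ) (gap N y k) (0 < k) 10
      (run describeLeft σ1).rreg := by
    refine describe_spec h1 p14 p1 hg (Or.inl rfl) (by simp [h1.pos]) rfl (fun τ _ h11 => ?_)
      (fun hk0 => ?_)
    · simp [h11]
    · have := hle (k - 1) (by omega)
      simpa using this
  have hok2 : Ok s describeLeft σ1 :=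
    describe_ok hs (i := k - 1) (by omega) (by simp [h1.pos]) h1.card
  have h2 : Located N k t y W X (run describeLeft σ1) :=
    h1.of_run (by decide) (by decide) (by decide)
  have q14 : (run describeLeft σ1).ireg 14 = k - 2 := by rw [run_ireg _ _ _ (by decide), p14]
  have q1 : (run describeLeft σ1).rreg 1 = gap N y k := by rw [run_rreg _ _ _ (by decide), p1]
  set σ2 := run describeLeft σ1 with hσ2
  have hR : NodeData N y (k - 2) k t ((-1 : ℚ) : ℝ) (gap N y k) (k < N) 30
      (run describeRight σ2).rreg := by
    refine describe_spec h2 q14 q1 hg (Or.inr rfl) (by simp [h2.pos]) rfl (fun τ h10 h11 => ?_)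
      (fun hkN => ?_)
    · simp [h11, h10]
    · have := hlt k le_rfl hkN
      push_cast
      linarith
  have hok3 : Ok s describeRight σ2 := describe_ok hs hk (by simp [h2.pos]) h2.card
  have h3 : Located N k t y W X (run describeRight σ2) :=
    h2.of_run (by decide) (by decide) (by decide)
  have r14 : (run describeRight σ2).ireg 14 = k - 2 := by rw [run_ireg _ _ _ (by decide), q14]
  have hL3 : NodeData N y (k - 2) (k - 1) t ((1 : ℚ) : ℝ) (gap N y k) (0 < k) 10
      (run describeRight σ2).rreg := hL.congr fun r hr => by
    interval_cases r <;> exact run_rreg _ _ _ (by decide)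
  set σ3 := run describeRight σ2 with hσ3
  refine Ends.prog ?_ (by decide) ?_
  · rw [ok_append, ok_append, ok_append]
    exact ⟨hok1, hok2, hok3, output_ok h3 hs hW⟩
  · rw [run_append, run_append, run_append]
    obtain ⟨o0, oj⟩ := output_spec h3 r14
    rw [Rat.cast_one] at hL3
    rw [Rat.cast_neg, Rat.cast_one] at hR
    have hW' := (run_mem output σ3 (by decide)).1
    have hX' := (run_mem output σ3 (by decide)).2
    have hreg : ∀ r, (run output σ3).rreg r = σ3.rreg r := fun r =>
      run_rreg _ _ _ (by simp [output, Instr.realTargets])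
    exact ⟨hW'.trans h3.imem, hX'.trans h3.rmem, o0, oj, hL3.congr fun r _ => hreg _,
      hR.congr fun r _ => hreg _⟩

lemma searchLoop_ends {s n : ℕ} (hs : 3 * N + 3 ≤ s) (hn : N < 2 ^ n)
    (h : Located N 0 t y W X σ) (h13 : σ.ireg 13 = N)
    (hy : ∀ i j, i < j → j < N → y i < y j) :
    Ends s (n * 60 + 3) searchLoop σ fun τ => ∃ k ≤ N, Located N k t y W X τ ∧
      (∀ i < k, y i ≤ t) ∧ ∀ i, k ≤ i → i < N → t < y i := by
  refine (Ends.loop (B := 50) (fun n τ => ∃ lo hi, Located N lo t y W X τ ∧ τ.ireg 13 = hi ∧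
    lo ≤ hi ∧ hi ≤ N ∧ hi - lo < 2 ^ n ∧ (∀ i < lo, y i ≤ t) ∧ ∀ i, hi ≤ i → i < N → t < y i)
    ?_ n σ ⟨0, N, h, h13, by omega, le_rfl, by omega, by omega, by omega⟩).mono ?_ ?_
  · rintro n τ ⟨lo, hi, hτ, r13, r1, r2, r3, r4, r5⟩ hb
    simp only [Test.Holds, IExp.val, hτ.pos, r13] at hb
    obtain ⟨n, rfl⟩ : ∃ n', n = n' + 1 := by
      refine Nat.exists_eq_succ_of_ne_zero fun h => ?_
      rw [h, pow_zero] at r3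
      omega
    rw [pow_succ] at r3
    obtain ⟨s10, s11, s12, s0, sW, sX, sy⟩ := hτ
    set mid := (lo + hi) / 2 with hmid
    by_cases c : t < y mid
    · refine ⟨n, rfl, Ends.prog ?_ (by decide) ⟨lo, mid, ⟨?_, ?_, ?_, s0, sW, sX, sy⟩, ?_, by omega,
        by omega, by omega, r4, fun i hi1 hi2 => ?_⟩⟩
      · simp [s11, r13, s12, sX, sW, sy, s0, c, ← hmid, Sel.pick_rlt]; omega
      · rw [run_ireg _ _ _ (by decide)]; exact s10
      · simp [s11, r13, s12, sX, sW, sy, s0, c, ← hmid, Sel.pick_rlt]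
      · rw [run_ireg _ _ _ (by decide)]; exact s12
      · simp [s11, r13, s12, sX, sW, sy, s0, c, ← hmid, Sel.pick_rlt]
      · rcases hi1.eq_or_lt with e | e
        · rwa [← e]
        · exact c.trans (hy _ _ e hi2)
    · refine ⟨n, rfl, Ends.prog ?_ (by decide) ⟨mid + 1, hi, ⟨?_, ?_, ?_, s0, sW, sX, sy⟩, ?_,
        by omega, by omega, by omega, fun i hi => ?_, r5⟩⟩
      · simp [s11, r13, s12, sX, sW, sy, s0, c, ← hmid, Sel.pick_rlt]; omega
      · rw [run_ireg _ _ _ (by decide)]; exact s10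
      · simp [s11, r13, s12, sX, sW, sy, s0, c, ← hmid, Sel.pick_rlt]
      · rw [run_ireg _ _ _ (by decide)]; exact s12
      · simp [s11, r13, s12, sX, sW, sy, s0, c, ← hmid, Sel.pick_rlt]
      · rcases (Nat.lt_succ_iff.1 hi).eq_or_lt with e | e
        · rw [e]; exact not_lt.1 c
        · exact (hy _ _ e (by omega)).le.trans (not_lt.1 c)
  · simp only [Test.cost, IExp.cost]; omega
  · rintro τ ⟨hb, m, lo, hi, hτ, r13, r1, r2, r3, r4, r5⟩
    simp only [Test.Holds, IExp.val, hτ.pos, r13] at hb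
    obtain rfl : lo = hi := by omega
    exact ⟨lo, r2, hτ, r4, r5⟩

lemma query_ends {s : ℕ} (hs : 3 * N + 3 ≤ s) (μ : State) (h0 : μ.imem 0 = N)
    (hle : ∀ a, μ.imem a ≤ N) (hy : ∀ i j, i < j → j < N → μ.rmem (μ.imem (2 * N + i)) <
      μ.rmem (μ.imem (2 * N + j))) (t : ℝ) :
    Ends s (Nat.log 2 N * 60 + 1200) query (queryState μ t) fun τ => ∃ k ≤ N,
      (∀ i < k, μ.rmem (μ.imem (2 * N + i)) ≤ t) ∧
      (∀ i, k ≤ i → i < N → t < μ.rmem (μ.imem (2 * N + i))) ∧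
      Answer N k t (fun i => μ.rmem (μ.imem (2 * N + i))) μ.imem μ.rmem τ := by
  refine (Ends.seq (B := 20) (Q := fun τ => Located N 0 t (fun i => μ.rmem (μ.imem (2 * N + i)))
    μ.imem μ.rmem τ ∧ τ.ireg 13 = N) (Ends.prog ?_ (by decide) ?_) ?_).mono
    (B := 20 + (((Nat.log 2 N + 1) * 60 + 3) + 1000)) (by omega) fun τ h => h
  · simp [setup, queryState, h0]; omega
  · refine ⟨⟨?_, ?_, ?_, rfl, rfl, rfl, fun _ => rfl⟩, ?_⟩ <;>
      simp [setup, queryState, h0, two_mul]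
  · rintro τ ⟨hτ, h13⟩
    refine Ends.seq (searchLoop_ends hs (Nat.lt_pow_succ_log_self (by norm_num) N) hτ h13 hy) ?_
    rintro υ ⟨k, hk, hυ, hle', hlt⟩
    exact (respond_ends hs hk hυ hle hy hle' hlt).mono le_rfl fun τ h => ⟨k, hk, hle', hlt, h⟩

end Query

end RealRAM

/-! ### The evaluation program -/

namespace RealRAM

namespace Query

open NonnegC2

/-- The selected value, when the registers `α, …, α + 3` hold a selector. -/
def pickExp (α : ℕ) : RExp :=
  .add (.add (.add (.mul (.reg α) (.mem (.const 0))) (.mul (.reg (α + 1)) (.mem (.const 1))))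
    (.mul (.reg (α + 2)) (.mem (.const 2)))) (.mul (.reg (α + 3)) (.mem (.const 3)))

/-- Computes the contribution of the node described in the real registers from `b` on, and leaves
its jet in the real registers `o`, `o + 1`, `o + 2`. -/
def contribute (b o : ℕ) : List Instr :=
  [.setR 3 (.leaf (pickExp (b + 5))), .setR 4 (.leaf (pickExp (b + 9))),
    .setR 5 (.ite (.rlt (.mul (.const 2) (.reg 3)) (.reg 4)) (.leaf (.const 0))
      (.leaf (.mul (.sub (.reg 4) (.reg 3)) (.reg (b + 1))))),
    .setR 6 (.leaf (.div (.mul (.reg 5) (.reg 5)) (.mul (.const 4) (.reg 3)))),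
    .setR 7 (.leaf (.add (.add (.reg 3) (.mul (.reg 5) (.reg b)))
      (.mul (.reg 6) (.mul (.reg b) (.reg b))))),
    .setR 8 (.leaf (.add (.reg 5) (.mul (.mul (.const 2) (.reg 6)) (.reg b)))),
    .setR 9 (.leaf (.mul (.const 2) (.reg 6))),
    .setR o (.leaf (.mul (.reg (b + 2)) (.reg 7))),
    .setR (o + 1) (.leaf (.add (.mul (.reg (b + 3)) (.reg 7)) (.mul (.reg (b + 2)) (.reg 8)))),
    .setR (o + 2) (.leaf (.add (.add (.mul (.reg (b + 4)) (.reg 7))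
      (.mul (.mul (.const 2) (.reg (b + 3))) (.reg 8))) (.mul (.reg (b + 2)) (.reg 9))))]

/-- The evaluation program. -/
def evaluate : List Instr :=
  contribute 10 50 ++ (contribute 30 60 ++
    [.setR 0 (.leaf (.add (.reg 50) (.reg 60))), .setR 1 (.leaf (.add (.reg 51) (.reg 61))),
      .setR 2 (.leaf (.add (.reg 52) (.reg 62)))])

/-- The value of `pickExp`. -/
def pickVal (α : ℕ) (ρ M : ℕ → ℝ) : ℝ :=
  ρ α * M 0 + ρ (α + 1) * M 1 + ρ (α + 2) * M 2 + ρ (α + 3) * M 3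

/-- The jet that `contribute` computes. -/
noncomputable def contribution (b : ℕ) (ρ M : ℕ → ℝ) : Fin 3 → ℝ :=
  jmul (fun m => ρ (b + 2 + m)) (quadJet (pickVal (b + 5) ρ M)
    (slopeOf (pickVal (b + 5) ρ M) (pickVal (b + 9) ρ M) (ρ (b + 1))) (ρ b))

lemma contribute_spec {b o : ℕ} (hb : b = 10 ∨ b = 30) (ho : o = 50 ∨ o = 60) (σ : State)
    (m : Fin 3) :
    (run (contribute b o) σ).rreg (o + m) = contribution b σ.rreg σ.rmem m := by
  obtain ⟨I, ρ, W, X⟩ := σ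
  simp only
  set fa := pickVal (b + 5) ρ X with hfa
  set fb := pickVal (b + 9) ρ X with hfb
  set p := slopeOf fa fb (ρ (b + 1)) with hp
  set ρ' : ℕ → ℝ := Function.update (Function.update (Function.update ρ 3 fa) 4 fb) 5 p with hρ'
  have h3 : ρ' 3 = fa := by simp [hρ']
  have h5 : ρ' 5 = p := by simp [hρ']
  have hge : ∀ j, 5 < j → ρ' j = ρ j := fun j hj => by
    rw [hρ', Function.update_of_ne (by omega), Function.update_of_ne (by omega),
      Function.update_of_ne (by omega)]
  have hstage : ∀ l, run (.setR 3 (.leaf (pickExp (b + 5))) :: .setR 4 (.leaf (pickExp (b + 9))) ::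
      .setR 5 (.ite (.rlt (.mul (.const 2) (.reg 3)) (.reg 4)) (.leaf (.const 0))
        (.leaf (.mul (.sub (.reg 4) (.reg 3)) (.reg (b + 1))))) :: l) ⟨I, ρ, W, X⟩ =
      run l ⟨I, ρ', W, X⟩ := fun l => by
    rw [run, run, run]
    congr 1
    have e1 : (Instr.run ⟨I, ρ, W, X⟩ (.setR 3 (.leaf (pickExp (b + 5))))) =
        ⟨I, Function.update ρ 3 fa, W, X⟩ := rfl
    have e2 : (Instr.run ⟨I, Function.update ρ 3 fa, W, X⟩ (.setR 4 (.leaf (pickExp (b + 9))))) =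
        ⟨I, Function.update (Function.update ρ 3 fa) 4 fb, W, X⟩ := by
      simp only [Instr.run, Sel.pick_leaf, State.setR, pickExp, RExp.val, IExp.val]
      rw [Function.update_of_ne (by omega), Function.update_of_ne (by omega),
        Function.update_of_ne (by omega), Function.update_of_ne (by omega)]
      rfl
    rw [e1, e2]
    have n1 : b + 1 ≠ 4 := by omega
    have n2 : b + 1 ≠ 3 := by omega
    simp only [Instr.run, Sel.pick_leaf, Sel.pick_rlt, State.setR, RExp.val, hρ', hp, slopeOf,
      apply_ite (RExp.val _), Function.update_self, Function.update_of_ne n1,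
      Function.update_of_ne n2, Function.update_of_ne (show (3 : ℕ) ≠ 4 by decide), Rat.cast_zero,
      Rat.cast_ofNat]
  rw [contribute, hstage]
  simp only [contribution, ← hfa, ← hfb, ← hp]
  clear_value ρ' p fa fb
  have hc : ∀ j, 10 ≤ j → ρ j = ρ' j := fun j hj => (hge j (by omega)).symm
  rw [hc b (by omega)]
  simp only [jmul, quadJet, Matrix.cons_val, ← h3, ← h5]
  rw [hc (b + 2 + (0 : Fin 3)) (by omega), hc (b + 2 + (1 : Fin 3)) (by omega),
    hc (b + 2 + (2 : Fin 3)) (by omega)]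
  rcases hb with rfl | rfl <;> rcases ho with rfl | rfl <;> fin_cases m <;> simp

lemma evaluate_spec (σ : State) (m : Fin 3) :
    (run evaluate σ).rreg m =
      contribution 10 σ.rreg σ.rmem m + contribution 30 σ.rreg σ.rmem m := by
  have h2 := contribute_spec (b := 30) (o := 60) (Or.inr rfl) (Or.inr rfl)
    (run (contribute 10 50) σ) m
  have h1 := contribute_spec (b := 10) (o := 50) (Or.inl rfl) (Or.inl rfl) σ m
  have hmem := (run_mem (contribute 10 50) σ (by decide)).2
  have hreg : ∀ r < 13, (run (contribute 10 50) σ).rreg (30 + r) = σ.rreg (30 + r) := fun r hr =>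
    run_rreg _ _ _ (by interval_cases r <;> decide)
  have hpick : ∀ r ≤ 9, pickVal (30 + r) (run (contribute 10 50) σ).rreg σ.rmem =
      pickVal (30 + r) σ.rreg σ.rmem := fun r hr => by
    simp only [pickVal, add_assoc]
    rw [hreg _ (by omega), hreg _ (by omega), hreg _ (by omega), hreg _ (by omega)]
  have hcut : (fun m : Fin 3 => (run (contribute 10 50) σ).rreg (30 + 2 + m)) =
      fun m : Fin 3 => σ.rreg (30 + 2 + m) := funext fun m => by
    rw [add_assoc, hreg _ (by omega)]
  have h2' : contribution 30 (run (contribute 10 50) σ).rreg (run (contribute 10 50) σ).rmem =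
      contribution 30 σ.rreg σ.rmem := by
    rw [contribution, contribution, hmem, hcut, hpick 5 (by omega), hpick 9 (by omega),
      hreg 1 (by omega), show (run (contribute 10 50) σ).rreg 30 = σ.rreg 30 from
        hreg 0 (by omega)]
  have h1' : (run (contribute 30 60) (run (contribute 10 50) σ)).rreg (50 + m) =
      contribution 10 σ.rreg σ.rmem m := by
    rw [← h1]
    fin_cases m <;> exact run_rreg _ _ _ (by decide)
  rw [h2'] at h2
  rw [evaluate, run_append, run_append, ← h1', ← h2]
  generalize run (contribute 30 60) (run (contribute 10 50) σ) = τ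
  fin_cases m <;> simp

lemma evaluate_ends {s : ℕ} (σ : State) :
    Ends s 500 (prog evaluate) σ fun τ => ∀ m : Fin 3,
      τ.rreg m = contribution 10 σ.rreg σ.rmem m + contribution 30 σ.rreg σ.rmem m :=
  Ends.prog (by simp [evaluate, contribute]) (by decide) (evaluate_spec σ)

variable {N k : ℕ} {t : ℝ} {y : ℕ → ℝ} {W : ℕ → ℕ} {X : ℕ → ℝ}

lemma pickVal_eq {α lo i : ℕ} {ρ M : ℕ → ℝ} (h : ∀ r < 4, ρ (α + r) = if lo + r = i then 1 else 0)
    (h1 : lo ≤ i) (h2 : i < lo + 4) : pickVal α ρ M = M (i - lo) := by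
  have e0 : ρ α = _ := h 0 (by norm_num)
  rw [pickVal, e0, h 1 (by norm_num), h 2 (by norm_num), h 3 (by norm_num)]
  obtain ⟨j, rfl⟩ : ∃ j, i = lo + j := ⟨i - lo, by omega⟩
  have hj : j < 4 := by omega
  interval_cases j <;> simp

lemma NodeData.contribution_eq {i b : ℕ} {sg g : ℝ} {act : Prop} [Decidable act]
    {ρ ρ' M z : ℕ → ℝ} (h : NodeData N y (k - 2) i t sg g act b ρ)
    (hρ : ∀ j < 50, ρ' j = ρ j) (hb : b ≤ 30)
    (hM : ∀ j < min (k + 2) N - (k - 2), M j = z (k - 2 + j))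
    (hact : act → i < N ∧ (i + 1 = k ∨ i = k)) :
    contribution b ρ' M = if act then sideJet N y z sg g i t else 0 := by
  have hcut : (fun m : Fin 3 => ρ' (b + 2 + m)) = if act then cutJet sg g (t - y i) else 0 := by
    funext m
    rw [hρ _ (by omega), h.cut m]
    split_ifs <;> rfl
  rw [contribution, hcut]
  split_ifs with ha
  · obtain ⟨hiN, hik⟩ := hact ha
    obtain ⟨w1, w2⟩ := nearest_mem_window (y := y) hik hiN
    have p1 : pickVal (b + 5) ρ' M = z i := by
      rw [pickVal_eq (lo := k - 2) (i := i) (fun r hr => (hρ _ (by omega)).trans (h.self r hr))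
        (by omega) (by omega), hM _ (by omega)]
      congr 1; omega
    have p2 : pickVal (b + 9) ρ' M = z (nearest N y i) := by
      rw [pickVal_eq (lo := k - 2) (i := nearest N y i)
        (fun r hr => (hρ _ (by omega)).trans (h.other r hr)) (by omega) (by omega), hM _ (by omega)]
      congr 1; omega
    rw [p1, p2, hρ _ (by omega), hρ _ (by omega), h.dist, h.recip]
    rfl
  · exact zero_jmul _

/-- The evaluation program, supplied with the answer to a query and with the values in the window,
computes the jet of the interpolant. -/
lemma Answer.evaluate_ends {s : ℕ} {τ σ : State} {z : ℕ → ℝ} (h : Answer N k t y W X τ)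
    (hy : ∀ i j, i < j → j < N → y i < y j) (hk : k ≤ N) (hle : ∀ i < k, y i ≤ t)
    (hlt : ∀ i, k ≤ i → i < N → t < y i) (hρ : ∀ j < 50, σ.rreg j = τ.rreg j)
    (hM : ∀ j < min (k + 2) N - (k - 2), σ.rmem j = z (k - 2 + j)) :
    Ends s 500 (prog evaluate) σ fun υ => ∀ m : Fin 3, υ.rreg m = splineJet N y z t m := by
  refine (Query.evaluate_ends σ).mono le_rfl fun υ hυ m => ?_
  rw [hυ m, h.left.contribution_eq hρ (by omega) hM (fun ha => by omega),
    h.right.contribution_eq hρ (by omega) hM (fun ha => by omega), splineJet_eq hy hk hle hlt,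
    Pi.add_apply]

end Query

end RealRAM

namespace NonnegC2

/-! ### The interpolation operator of a finite set -/

variable {E : Finset ℝ}

/-- The points of `E` in increasing order, followed by zeros. -/
noncomputable def nodes (E : Finset ℝ) (i : ℕ) : ℝ :=
  if h : i < E.card then E.orderEmbOfFin rfl ⟨i, h⟩ else 0

/-- The values of `f` at the points of `E` in increasing order, followed by zeros. -/
noncomputable def values (f : E → ℝ≥0) (i : ℕ) : ℝ :=
  if h : i < E.card then (f ⟨E.orderEmbOfFin rfl ⟨i, h⟩, E.orderEmbOfFin_mem rfl _⟩ : ℝ) else 0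

lemma nodes_lt (i j : ℕ) (hij : i < j) (hj : j < E.card) : nodes E i < nodes E j := by
  rw [nodes, nodes, dif_pos hj, dif_pos (hij.trans hj)]
  exact (E.orderEmbOfFin rfl).strictMono hij

lemma values_nonneg (f : E → ℝ≥0) (i : ℕ) : 0 ≤ values f i := by
  unfold values
  split_ifs <;> simp

lemma values_eq (f : E → ℝ≥0) {i : ℕ} (hi : i < E.card) {a : E} (ha : (a : ℝ) = nodes E i) :
    values f i = f a := by
  rw [nodes, dif_pos hi] at ha
  rw [values, dif_pos hi]
  congr 2
  exact Subtype.ext ha.symm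

lemma exists_node (a : E) : ∃ i < E.card, (a : ℝ) = nodes E i := by
  have : (a : ℝ) ∈ Set.range (E.orderEmbOfFin rfl) := by
    rw [Finset.range_orderEmbOfFin]; exact a.2
  obtain ⟨⟨i, hi⟩, h⟩ := this
  exact ⟨i, hi, by rw [nodes, dif_pos hi, h]⟩

/-- The jets of the interpolant of `f`. -/
noncomputable def interpJet (f : E → ℝ≥0) : ℝ → Fin 3 → ℝ := splineJet E.card (nodes E) (values f)

/-- The interpolant of `f`. -/
noncomputable def interp (f : E → ℝ≥0) (t : ℝ) : ℝ := interpJet f t 0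

lemma isTwoJet_interpJet (f : E → ℝ≥0) : IsTwoJet (interpJet f) := isTwoJet_splineJet _ _ _

lemma iteratedDeriv_interp (f : E → ℝ≥0) (m : Fin 3) (t : ℝ) :
    iteratedDeriv m (interp f) t = interpJet f t m :=
  (isTwoJet_interpJet f).iteratedDeriv_eq m t

lemma jet2_mem (F : ℝ → ℝ) (t : ℝ) : jet2 F t ∈ Polynomial.degreeLE ℝ 2 := by
  refine Submodule.sum_mem _ fun m hm => Polynomial.mem_degreeLE.2 ?_
  rw [Finset.mem_range] at hm
  rw [← Polynomial.smul_eq_C_mul]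
  refine (Polynomial.degree_smul_le _ _).trans ?_
  rw [Polynomial.degree_pow, Polynomial.degree_X_sub_C, nsmul_one]
  exact_mod_cast Nat.lt_succ_iff.1 hm

lemma eval_derivative_jet2 (F : ℝ → ℝ) (t : ℝ) (m : Fin 3) :
    (Polynomial.derivative^[(m : ℕ)] (jet2 F t)).eval t = iteratedDeriv m F t := by
  fin_cases m <;> simp [jet2, Finset.sum_range_succ, Polynomial.derivative_pow]

lemma jet2_congr {F G : ℝ → ℝ} {t : ℝ}
    (h : ∀ m : Fin 3, iteratedDeriv m F t = iteratedDeriv m G t) : jet2 F t = jet2 G t := by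
  refine Finset.sum_congr rfl fun m hm => ?_
  rw [h ⟨m, Finset.mem_range.1 hm⟩]

lemma c2Norm_le {F : ℝ → ℝ} {B : ℝ} (h : ∀ (m : Fin 3) t, |iteratedDeriv m F t| ≤ B) :
    c2Norm F ≤ ENNReal.ofReal B :=
  iSup_le fun t => iSup_le fun m => by
    rw [Real.enorm_eq_ofReal_abs]
    exact ENNReal.ofReal_le_ofReal (h m t)

lemma abs_iteratedDeriv_le {G : ℝ → ℝ} (hG : c2Norm G < ∞) (m : Fin 3) (t : ℝ) :
    |iteratedDeriv m G t| ≤ (c2Norm G).toReal := by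
  have h : ‖iteratedDeriv m G t‖ₑ ≤ c2Norm G :=
    le_iSup_of_le t (le_iSup (fun m : Fin 3 => ‖iteratedDeriv m G t‖ₑ) m)
  have := ENNReal.toReal_mono hG.ne h
  rwa [toReal_enorm] at this

lemma isC2Plus_interp (f : E → ℝ≥0) : IsC2Plus (interp f) := by
  refine ⟨(isTwoJet_interpJet f).contDiff, ?_, splineJet_zero_nonneg (values_nonneg f)⟩
  obtain ⟨M, hM, hc⟩ := exists_compatible (N := E.card) nodes_lt (values_nonneg f)
  refine (c2Norm_le (B := 400 * M) fun m t => ?_).trans_lt ENNReal.ofReal_lt_top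
  rw [iteratedDeriv_interp]
  exact hc.abs_splineJet_le hM nodes_lt (values_nonneg f) t m

lemma interp_apply (f : E → ℝ≥0) (a : E) : interp f a = f a := by
  obtain ⟨i, hi, ha⟩ := exists_node a
  rw [← values_eq f hi ha, ha]
  exact splineJet_node nodes_lt hi

lemma c2Norm_interp_le (f : E → ℝ≥0) {C : ℕ} (hC : 400 ≤ C) :
    c2Norm (interp f) ≤ (C : ℝ≥0∞) * traceNorm f := by
  have hC0 : (C : ℝ≥0∞) ≠ 0 := by
    simp only [ne_eq, Nat.cast_eq_zero]; omega
  unfold traceNorm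
  rw [ENNReal.mul_iInf_of_ne hC0 (ENNReal.natCast_ne_top C)]
  refine le_iInf fun G => ?_
  rw [ENNReal.mul_iInf_of_ne hC0 (ENNReal.natCast_ne_top C)]
  refine le_iInf fun ⟨⟨hG, hfin, hG0⟩, hGf⟩ => ?_
  set M := (c2Norm G).toReal with hM
  have hM0 : 0 ≤ M := ENNReal.toReal_nonneg
  have hval : ∀ i < E.card, values f i = G (nodes E i) := fun i hi => by
    have ha : nodes E i ∈ E := by
      rw [nodes, dif_pos hi]; exact E.orderEmbOfFin_mem rfl _
    rw [values_eq f hi (a := ⟨nodes E i, ha⟩) rfl, ← hGf]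
  have hc := compatible_of_function hG hG0 (abs_iteratedDeriv_le hfin) E.card hval
  calc c2Norm (interp f) ≤ ENNReal.ofReal (400 * M) := c2Norm_le fun m t => by
        rw [iteratedDeriv_interp]
        exact hc.abs_splineJet_le hM0 nodes_lt (values_nonneg f) t m
    _ ≤ ENNReal.ofReal (C * M) := ENNReal.ofReal_le_ofReal
        (mul_le_mul_of_nonneg_right (by exact_mod_cast hC) hM0)
    _ = C * c2Norm G := by
        rw [ENNReal.ofReal_mul (by positivity), ENNReal.ofReal_natCast, hM,
          ENNReal.ofReal_toReal hfin.ne]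

/-- The jet at `t` of the interpolant, as a map of the data. -/
noncomputable def jetMap (E : Finset ℝ) (t : ℝ) (f : E → ℝ≥0) : Polynomial.degreeLE ℝ 2 :=
  ⟨jet2 (interp f) t, jet2_mem _ _⟩

/-! ### Operation counts -/

lemma natLog_le (N : ℕ) : (Nat.log 2 N : ℝ) ≤ 3 / 2 * Real.log N := by
  rcases Nat.eq_zero_or_pos N with rfl | hN
  · simp
  have h : ((2 ^ Nat.log 2 N : ℕ) : ℝ) ≤ N := by exact_mod_cast Nat.pow_log_le_self 2 hN.ne'
  have h1 := Real.log_le_log (by positivity) h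
  rw [Nat.cast_pow, Real.log_pow] at h1
  have h2 := Real.log_two_gt_d9
  have h3 : (0 : ℝ) ≤ Nat.log 2 N := Nat.cast_nonneg _
  push_cast at h1
  nlinarith

lemma sort_time_le {N T : ℕ} (h : T ≤ N * (Nat.log 2 N * 60 + 200) + 20) :
    (T : ℝ) ≤ 2000 * (1 + N * Real.log N) := by
  have hT : (T : ℝ) ≤ N * (Nat.log 2 N * 60 + 200) + 20 := by exact_mod_cast h
  have h1 := mul_le_mul_of_nonneg_left (natLog_le N) (Nat.cast_nonneg (α := ℝ) N)
  have h0 : 0 ≤ Real.log N := Real.log_natCast_nonneg N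
  have h00 : 0 ≤ N * Real.log N := mul_nonneg (Nat.cast_nonneg _) h0
  have h2 : (N : ℝ) ≤ 1 + 3 / 2 * (N * Real.log N) := by
    rcases Nat.lt_or_ge N 2 with hN | hN
    · have : (N : ℝ) ≤ 1 := by exact_mod_cast Nat.lt_succ_iff.1 hN
      linarith
    · have h3 : Real.log 2 ≤ Real.log N := Real.log_le_log (by norm_num) (by exact_mod_cast hN)
      have h4 := Real.log_two_gt_d9
      have h5 : (0 : ℝ) ≤ N := Nat.cast_nonneg _
      nlinarith
  linarith

lemma query_time_le {N T : ℕ} (h : T ≤ Nat.log 2 N * 60 + 1200) :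
    (T : ℝ) ≤ 2000 * (1 + Real.log N) := by
  have hT : (T : ℝ) ≤ Nat.log 2 N * 60 + 1200 := by exact_mod_cast h
  have h1 := natLog_le N
  have h0 : 0 ≤ Real.log N := Real.log_natCast_nonneg N
  linarith

end NonnegC2

/-! ### Correctness of the algorithm -/

namespace RealRAM

open NonnegC2 Query

variable {E : Finset ℝ}

/-- The sorted list of indices enumerates the points of `E` in increasing order. -/
lemma sorted_eq_nodes (e : Fin E.card ≃ E) {W : ℕ → ℕ}
    (h : Tournament.Partial E.card (initState fun i => (e i : ℝ)).rmem W E.card) (i : ℕ)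
    (hi : i < E.card) :
    (e ⟨W (2 * E.card + i), h.out_lt i hi⟩ : ℝ) = nodes E i ∧
      (initState fun i => (e i : ℝ)).rmem (W (2 * E.card + i)) = nodes E i := by
  have hX : ∀ i (hi : i < E.card), (initState fun i => (e i : ℝ)).rmem (W (2 * E.card + i)) =
      (e ⟨W (2 * E.card + i), h.out_lt i hi⟩ : ℝ) := fun i hi => by
    simp [initState, h.out_lt i hi]
  have huniq := Finset.orderEmbOfFin_unique (s := E) rfl
    (f := fun i : Fin E.card => (e ⟨W (2 * E.card + i), h.out_lt i i.2⟩ : ℝ)) (fun i => (e _).2)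
    (fun i j hij => by
      have := h.sorted i j hij j.2
      rwa [hX i i.2, hX j j.2] at this)
  have h1 : (e ⟨W (2 * E.card + i), h.out_lt i hi⟩ : ℝ) = nodes E i := by
    rw [nodes, dif_pos hi, ← huniq]
  exact ⟨h1, (hX i hi).trans h1⟩

/-- After sorting, every query is answered with an efficient representation. -/
lemma query_correct (e : Fin E.card ≃ E) {μ : State}
    (hX : μ.rmem = (initState fun i => (e i : ℝ)).rmem)
    (hP : Tournament.Partial E.card (initState fun i => (e i : ℝ)).rmem μ.imem E.card) (t : ℝ) :
    ∃ (T' : ℕ) (τ : State) (r : EffRep E.card 50),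
      Exec (2000 * (1 + E.card)) query (queryState μ t) T' τ ∧
      (T' : ℝ) ≤ 2000 * (1 + Real.log E.card) ∧ τ.imem = μ.imem ∧ τ.rmem = μ.rmem ∧
      r.ReturnedBy τ ∧ r.Represents (prog evaluate) 4 2000 e t (jetMap E t) := by
  have hs := sorted_eq_nodes e hP
  set y : ℕ → ℝ := fun i => μ.rmem (μ.imem (2 * E.card + i)) with hy_def
  have hy_eq : ∀ i < E.card, y i = nodes E i := fun i hi => by
    rw [hy_def]; simp only [hX]; exact (hs i hi).2
  have hy : ∀ i j, i < j → j < E.card → y i < y j := fun i j hij hj => by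
    rw [hy_eq i (hij.trans hj), hy_eq j hj]; exact nodes_lt i j hij hj
  obtain ⟨T', τ, hT', hexec, k, hk, hle, hlt, hA⟩ :=
    query_ends (s := 2000 * (1 + E.card)) (by omega) μ hP.zero hP.le hy t
  have hwin : ∀ j : Fin (min (k + 2) E.card - (k - 2)), k - 2 + j < E.card := fun j => by omega
  have hd4 : min (k + 2) E.card - (k - 2) ≤ 4 := by omega
  have hinj : Function.Injective fun j : Fin (min (k + 2) E.card - (k - 2)) =>
      (⟨μ.imem (2 * E.card + (k - 2 + j)), hP.out_lt _ (hwin j)⟩ : Fin E.card) := by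
    intro i j hij
    have h : y (k - 2 + i) = y (k - 2 + j) := by
      simp only [hy_def, Fin.mk.injEq] at hij ⊢
      rw [hij]
    rcases lt_trichotomy i j with h' | h' | h'
    · exact absurd h (hy _ _ (by omega) (hwin j)).ne
    · exact h'
    · exact absurd h (hy _ _ (by omega) (hwin i)).ne'
  refine ⟨T', τ, ⟨_, _, hinj, fun j => τ.rreg j⟩, hexec, query_time_le hT', hA.imem, hA.rmem,
    ⟨hA.size, fun j => hA.index j (j.2.trans_le hd4), fun _ => rfl⟩, hd4, ?_, ?_⟩
  · intro f g hfg
    refine Subtype.ext (jet2_congr fun m => ?_)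
    rw [iteratedDeriv_interp, iteratedDeriv_interp, interpJet, interpJet,
      splineJet_congr_nodes (y' := y) (fun i hi => (hy_eq i hi).symm),
      splineJet_congr_nodes (y' := y) (fun i hi => (hy_eq i hi).symm)]
    refine congrFun (splineJet_congr_window hy hk hle hlt fun j hj => ?_) m
    have hj' := hwin ⟨j, hj⟩
    rw [values_eq f hj' (hs _ hj').1, values_eq g hj' (hs _ hj').1,
      hfg _ (Finset.mem_image.2 ⟨⟨j, hj⟩, Finset.mem_univ _, rfl⟩)]
  · intro f _
    obtain ⟨T, υ, hT, hev, hυ⟩ := hA.evaluate_ends (s := 2000) (σ := EffRep.evalState (K := 50)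
      ⟨_, _, hinj, fun j => τ.rreg j⟩ fun j =>
        (f (e ⟨μ.imem (2 * E.card + (k - 2 + j)), hP.out_lt _ (hwin j)⟩) : ℝ)) (z := values f) hy hk
      hle hlt
      (fun j hj => by simp [EffRep.evalState, hj])
      (fun j hj => by
        have hj' := hwin ⟨j, hj⟩
        rw [values_eq f hj' (hs _ hj').1]
        simp [EffRep.evalState, hj])
    refine ⟨T, υ, hT.trans (by norm_num), hev, fun m => ?_⟩
    rw [hυ m, jetMap, eval_derivative_jet2, iteratedDeriv_interp, interpJet,
      splineJet_congr_nodes (y' := y) (fun i hi => (hy_eq i hi).symm)]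

end RealRAM

open NonnegC2 RealRAM in
theorem mainTheorem3 :
    ∃ (C D₀ K : ℕ) (pre qry ev : RealRAM.Cmd), ∀ E : Finset ℝ,
      ∃ Ξ : ℝ → (E → ℝ≥0) → Polynomial.degreeLE ℝ 2,
        -- (A) bounded depth
        (∀ t : ℝ, HasDepth D₀ (Ξ t)) ∧
        -- (B) the jets are those of a bounded nonnegative extension
        (∀ f : E → ℝ≥0, ∃ F : ℝ → ℝ, IsC2Plus F ∧
          (∀ t : ℝ, jet2 F t = (Ξ t f : ℝ[X])) ∧
          c2Norm F ≤ (C : ℝ≥0∞) * traceNorm f ∧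
          ∀ a : E, F a = f a) ∧
        -- (C) the algorithm: one-time work, then queries, which leave the memory intact
        (∀ e : Fin E.card ≃ E, ∃ (T : ℕ) (μ : RealRAM.State),
          RealRAM.Exec (C * (1 + E.card)) pre (RealRAM.initState fun i => (e i : ℝ)) T μ ∧
          (T : ℝ) ≤ C * (1 + E.card * Real.log E.card) ∧
          ∀ t : ℝ, ∃ (T' : ℕ) (τ : RealRAM.State) (r : RealRAM.EffRep E.card K),
            RealRAM.Exec (C * (1 + E.card)) qry (RealRAM.queryState μ t) T' τ ∧
            (T' : ℝ) ≤ C * (1 + Real.log E.card) ∧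
            τ.imem = μ.imem ∧ τ.rmem = μ.rmem ∧
            r.ReturnedBy τ ∧
            r.Represents ev D₀ C e t (Ξ t)) := by
  -- `2000` exceeds the constants in the bounds for the norm, for the storage and for all operation
  -- counts; the constants returned by a query occupy the real registers below `50`
  refine ⟨2000, 4, 50, Tournament.sort, Query.query, prog Query.evaluate, fun E => ?_⟩
  have halg : ∀ e : Fin E.card ≃ E, ∃ (T : ℕ) (μ : State),
      Exec (2000 * (1 + E.card)) Tournament.sort (initState fun i => (e i : ℝ)) T μ ∧
      (T : ℝ) ≤ 2000 * (1 + E.card * Real.log E.card) ∧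
      ∀ t : ℝ, ∃ (T' : ℕ) (τ : State) (r : EffRep E.card 50),
        Exec (2000 * (1 + E.card)) Query.query (queryState μ t) T' τ ∧
        (T' : ℝ) ≤ 2000 * (1 + Real.log E.card) ∧ τ.imem = μ.imem ∧ τ.rmem = μ.rmem ∧
        r.ReturnedBy τ ∧ r.Represents (prog Query.evaluate) 4 2000 e t (jetMap E t) := fun e => by
    obtain ⟨T, μ, hT, hexec, hX, hP⟩ := Tournament.sort_ends (s := 2000 * (1 + E.card)) (by omega)
      (fun i => (e i : ℝ)) (Subtype.val_injective.comp e.injective)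
    exact ⟨T, μ, hexec, sort_time_le hT, query_correct e hX hP⟩
  refine ⟨jetMap E, fun t => ?_, fun f => ⟨interp f, isC2Plus_interp f, fun _ => rfl,
    c2Norm_interp_le f (by norm_num), interp_apply f⟩, by exact_mod_cast halg⟩
  -- the set of indices returned by a query witnesses the depth
  obtain ⟨-, μ, -, -, hq⟩ := halg E.equivFin.symm
  obtain ⟨-, τ, r, -, -, -, -, -, hd, hdep, -⟩ := hq t
  refine ⟨r.support E.equivFin.symm, ?_, hdep⟩
  exact Finset.card_image_le.trans (by simpa using hd)
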